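/- Let $N > 1$ be an integer and let $k$ be an integer relatively prime to $N$. For $\tau$ in the upper half plane $H$ let $L_\tau = \mathbb{Z}\cdot 2\pi i + \mathbb{Z}\cdot 2\pi i\tau$, and put $$g_2(\tau) = (2\pi i)^4\cdot 60 \sum_{0\ne w\in L_\tau} w^{-4},\qquad g_3(\tau) = (2\pi i)^6\cdot 140 \sum_{0\ne w\in L_\tau} w^{-6},$$ $$\Delta = g_2^3 - 27 g_3^2,\qquad j = g_2^3/\Delta,\qquad p_k(\tau) = \wp\bigl(L_\tau, 2\pi i k/N\bigr),\qquad f_k = g_2\, g_3\, p_k/\Delta,$$ where $\wp(L,u) = u^{-2} + \sum_{0\ne w\in L}\bigl((w-u)^{-2} - w^{-2}\bigr)$ is the Weierstrass $\wp$-function. Let $\Gamma_1(N)$ be the group of matrices $\begin{pmatrix} a&b\\ c&d\end{pmatrix}\in SL_2(\mathbb{Z})$ with $c\equiv 0$ and $a\equiv d\equiv 1 \pmod N$. A modular function for $\Gamma_1(N)$ is a meromorphic function $f$ on $H$ such that $f(\gamma\tau) = f(\tau)$ for all $\gamma\in\Gamma_1(N)$ and such that, for every $\gamma\in SL_2(\mathbb{Z})$,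 the function $f(\gamma\tau)$ is, for $\operatorname{Im}\tau$ large, a function of $e^{2\pi i\tau/N}$ that is meromorphic at $0$. Then $j$ and $f_k$ are meromorphic on $H$, and the subfield $\mathbb{C}(j, f_k)$ of the field of meromorphic functions on $H$ is the field of all modular functions for $\Gamma_1(N)$. -/

import Mathlib

open Filter Topology UpperHalfPlane
open scoped MatrixGroups

noncomputable section

namespace ModularFunctions

/-! ### The field of meromorphic functions on the upper half plane -/

/-- A function on the upper half plane is meromorphic if it is meromorphic at each point. -/
def IsMeromorphic (f : ℍ → ℂ) : Prop :=
  ∀ τ : ℍ, MeromorphicAt (fun z : ℂ => f (ofComplex z)) (τ : ℂ)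

/-- The `ℂ`-algebra of meromorphic functions `ℍ → ℂ` (functions with some value assigned at each
pole). -/
def meromorphicAlgebra : Subalgebra ℂ (ℍ → ℂ) where
  carrier := {f | IsMeromorphic f}
  mul_mem' := fun hf hg τ => (hf τ).mul (hg τ)
  add_mem' := fun hf hg τ => (hf τ).add (hg τ)
  algebraMap_mem' := fun c τ => MeromorphicAt.const c (τ : ℂ)

/-- The ideal of meromorphic functions that vanish outside a closed discrete subset of `ℍ`. -/
def negligibleIdeal : Ideal meromorphicAlgebra where
  carrier := {f | ∀ᶠ τ in codiscrete ℍ, f.1 τ = 0}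
  zero_mem' := by
    change ∀ᶠ τ in codiscrete ℍ, (0 : ℂ) = 0
    simp
  add_mem' := by
    intro f g hf hg
    change ∀ᶠ τ in codiscrete ℍ, f.1 τ = 0 at hf
    change ∀ᶠ τ in codiscrete ℍ, g.1 τ = 0 at hg
    change ∀ᶠ τ in codiscrete ℍ, f.1 τ + g.1 τ = 0
    filter_upwards [hf, hg] with τ h1 h2
    rw [h1, h2, add_zero]
  smul_mem' := by
    intro c f hf
    change ∀ᶠ τ in codiscrete ℍ, f.1 τ = 0 at hf
    change ∀ᶠ τ in codiscrete ℍ, c.1 τ * f.1 τ = 0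
    filter_upwards [hf] with τ h1
    rw [h1, mul_zero]

lemma codiscrete_neBot : (codiscrete ℍ).NeBot := by
  rw [neBot_iff]
  intro h
  have h1 : (∅ : Set ℍ) ∈ codiscrete ℍ := by rw [h]; trivial
  rw [← isOpenEmbedding_coe.isEmbedding.image_mem_codiscreteWithin_range, Set.image_empty,
    mem_codiscreteWithin_iff_forall_mem_nhdsNE] at h1
  have h2 := h1 _ ⟨UpperHalfPlane.I, rfl⟩
  have h3 := inter_mem h2 (nhdsWithin_le_nhds
    (isOpenEmbedding_coe.isOpen_range.mem_nhds ⟨UpperHalfPlane.I, rfl⟩))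
  rw [Set.empty_union, Set.compl_inter_self] at h3
  exact (NormedField.nhdsNE_neBot (UpperHalfPlane.I : ℂ)).ne (empty_mem_iff_bot.1 h3)

/-- A meromorphic function on `ℍ` that is not negligible has no zeros outside a closed discrete
set. -/
lemma eventually_ne_zero {f : ℍ → ℂ} (hf : IsMeromorphic f)
    (h : ¬ ∀ᶠ τ in codiscrete ℍ, f τ = 0) : ∀ᶠ τ in codiscrete ℍ, f τ ≠ 0 := by
  set F : ℂ → ℂ := fun z => f (ofComplex z) with hF
  have hFτ : ∀ τ : ℍ, F τ = f τ := fun τ => by simp [hF]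
  have hrange : Set.range ((↑) : ℍ → ℂ) = {z : ℂ | 0 < z.im} := UpperHalfPlane.range_coe
  have key : ∀ p : ℂ → Prop, (∀ᶠ τ : ℍ in codiscrete ℍ, p (F τ)) ↔
      ∀ᶠ z in codiscreteWithin {z : ℂ | 0 < z.im}, p (F z) := by
    intro p
    rw [Filter.Eventually, ← isOpenEmbedding_coe.isEmbedding.image_mem_codiscreteWithin_range,
      hrange]
    constructor
    · intro h1
      filter_upwards [h1] with z hz
      obtain ⟨τ, hτ, rfl⟩ := hz
      exact hτ
    · intro h1
      filter_upwards [h1, self_mem_codiscreteWithin _] with z hz hz'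
      exact ⟨⟨z, hz'⟩, hz, rfl⟩
  have hmer : MeromorphicOn F {z : ℂ | 0 < z.im} := fun z hz => hf ⟨z, hz⟩
  have hpre : IsPreconnected {z : ℂ | 0 < z.im} := (convex_halfSpace_im_gt 0).isPreconnected
  have goal : ∀ᶠ τ : ℍ in codiscrete ℍ, F τ ≠ 0 := by
    rw [key (fun w => w ≠ 0)]
    apply hmer.eventually_codiscreteWithin_apply_ne_zero
    intro x hx htop
    apply h
    have : ∀ᶠ τ : ℍ in codiscrete ℍ, F τ = 0 := by
      rw [key (fun w => w = 0), Filter.Eventually, mem_codiscreteWithin_iff_forall_mem_nhdsNE]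
      intro y hy
      have hy' : meromorphicOrderAt F y = ⊤ := by
        by_contra hne
        exact hmer.meromorphicOrderAt_ne_top_of_isPreconnected hpre hy hx hne htop
      filter_upwards [meromorphicOrderAt_eq_top_iff.1 hy'] with z hz
      exact Or.inl hz
    simpa only [hFτ] using this
  simpa only [hFτ] using goal

instance : negligibleIdeal.IsMaximal := by
  rw [Ideal.isMaximal_iff]
  refine ⟨fun h1 => ?_, fun J f hJ hf hfJ => ?_⟩
  · have := codiscrete_neBot
    obtain ⟨τ, hτ⟩ := Eventually.exists (f := codiscrete ℍ) h1
    exact one_ne_zero hτ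
  · have hne := eventually_ne_zero f.2 hf
    let g : meromorphicAlgebra := ⟨(f.1)⁻¹, fun τ => (f.2 τ).inv⟩
    have hmem : 1 - g * f ∈ negligibleIdeal := by
      change ∀ᶠ τ in codiscrete ℍ, 1 - (f.1 τ)⁻¹ * f.1 τ = 0
      filter_upwards [hne] with τ hτ
      rw [inv_mul_cancel₀ hτ, sub_self]
    have := J.add_mem (hJ hmem) (J.mul_mem_left g hfJ)
    simpa using this

/-- The field of meromorphic functions on the upper half plane: meromorphic functions `ℍ → ℂ`,
two of them being identified if they agree outside a closed discrete set. -/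
abbrev MeromorphicField : Type := meromorphicAlgebra ⧸ negligibleIdeal

instance : Field MeromorphicField := Ideal.Quotient.field negligibleIdeal

/-- The element of the field of meromorphic functions given by a meromorphic `f : ℍ → ℂ`. -/
def toField (f : ℍ → ℂ) (hf : IsMeromorphic f) : MeromorphicField :=
  Ideal.Quotient.mk negligibleIdeal ⟨f, hf⟩

/-! ### Modular functions -/

/-- `f (γ τ) = f τ` for all `γ ∈ Γ`, as an identity of meromorphic functions of `τ`. -/
def IsInvariant (Γ : Subgroup SL(2, ℤ)) (f : ℍ → ℂ) : Prop :=
  ∀ γ ∈ Γ, ∀ᶠ τ in codiscrete ℍ, f (γ • τ) = f τ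

/-- For each `γ ∈ SL(2, ℤ)`, the function `f (γ τ)` is, for `τ` with large imaginary part,
of the form `G (exp (2 π i τ / N))` with `G` meromorphic at `0` (as an identity of meromorphic
functions of `τ`, that is, up to a closed discrete set). -/
def IsMeromorphicAtCusps (N : ℕ) (f : ℍ → ℂ) : Prop :=
  ∀ γ : SL(2, ℤ), ∃ G : ℂ → ℂ, MeromorphicAt G 0 ∧
    ∀ᶠ τ : ℍ in codiscrete ℍ ⊓ atImInfty,
      f (γ • τ) = G (Complex.exp (2 * Real.pi * Complex.I * τ / N))

/-- The field of modular functions for a subgroup `Γ` of `SL(2, ℤ)` of level `N`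
(that is, containing `Γ(N)`), as a subfield of the field of meromorphic functions on `ℍ`. -/
def modularFunctionField (Γ : Subgroup SL(2, ℤ)) (N : ℕ) : IntermediateField ℂ MeromorphicField where
  carrier := {x | ∃ (f : ℍ → ℂ) (hf : IsMeromorphic f), toField f hf = x ∧
    IsInvariant Γ f ∧ IsMeromorphicAtCusps N f}
  mul_mem' := by
    rintro _ _ ⟨f, hf, rfl, hfi, hfc⟩ ⟨g, hg, rfl, hgi, hgc⟩
    refine ⟨f * g, fun τ => (hf τ).mul (hg τ), rfl, fun γ hγ => ?_, fun γ => ?_⟩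
    · filter_upwards [hfi γ hγ, hgi γ hγ] with τ h1 h2
      simp only [Pi.mul_apply, h1, h2]
    · obtain ⟨F, hF, h1⟩ := hfc γ
      obtain ⟨G, hG, h2⟩ := hgc γ
      refine ⟨F * G, hF.mul hG, ?_⟩
      filter_upwards [h1, h2] with τ h1 h2
      simp only [Pi.mul_apply, h1, h2]
  add_mem' := by
    rintro _ _ ⟨f, hf, rfl, hfi, hfc⟩ ⟨g, hg, rfl, hgi, hgc⟩
    refine ⟨f + g, fun τ => (hf τ).add (hg τ), rfl, fun γ hγ => ?_, fun γ => ?_⟩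
    · filter_upwards [hfi γ hγ, hgi γ hγ] with τ h1 h2
      simp only [Pi.add_apply, h1, h2]
    · obtain ⟨F, hF, h1⟩ := hfc γ
      obtain ⟨G, hG, h2⟩ := hgc γ
      refine ⟨F + G, hF.add hG, ?_⟩
      filter_upwards [h1, h2] with τ h1 h2
      simp only [Pi.add_apply, h1, h2]
  algebraMap_mem' := fun c =>
    ⟨fun _ => c, fun τ => MeromorphicAt.const c (τ : ℂ), rfl,
      fun _ _ => Eventually.of_forall fun _ => rfl,
      fun _ => ⟨fun _ => c, MeromorphicAt.const c 0, Eventually.of_forall fun _ => rfl⟩⟩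
  inv_mem' := by
    rintro _ ⟨f, hf, rfl, hfi, hfc⟩
    refine ⟨f⁻¹, fun τ => (hf τ).inv, ?_, fun γ hγ => ?_, fun γ => ?_⟩
    · by_cases h0 : ∀ᶠ τ in codiscrete ℍ, f τ = 0
      · have e1 : toField f hf = 0 := Ideal.Quotient.eq_zero_iff_mem.2 h0
        rw [e1, inv_zero]
        refine Ideal.Quotient.eq_zero_iff_mem.2 ?_
        change ∀ᶠ τ in codiscrete ℍ, (f τ)⁻¹ = 0
        filter_upwards [h0] with τ hτ
        rw [hτ, inv_zero]
      · refine eq_inv_of_mul_eq_one_left ?_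
        refine Ideal.Quotient.eq.2 ?_
        change ∀ᶠ τ in codiscrete ℍ, (f τ)⁻¹ * f τ - 1 = 0
        filter_upwards [eventually_ne_zero hf h0] with τ hτ
        rw [inv_mul_cancel₀ hτ, sub_self]
    · filter_upwards [hfi γ hγ] with τ h1
      simp only [Pi.inv_apply, h1]
    · obtain ⟨F, hF, h1⟩ := hfc γ
      refine ⟨F⁻¹, hF.inv, ?_⟩
      filter_upwards [h1] with τ h1
      simp only [Pi.inv_apply, h1]

/-! ### The functions `g₂`, `g₃`, `Δ`, `j`, `p_k`, `f_k` -/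

/-- The lattice `ℤ · 2πi + ℤ · 2πiτ`. -/
def periods (τ : ℍ) : PeriodPair where
  ω₁ := 2 * Real.pi * Complex.I
  ω₂ := 2 * Real.pi * Complex.I * τ
  indep := by
    rw [LinearIndependent.pair_iff]
    intro s t h
    have h2 : (2 * Real.pi * Complex.I : ℂ) ≠ 0 := Complex.two_pi_I_ne_zero
    have h3 : (s : ℂ) + t * (τ : ℂ) = 0 := by
      apply mul_left_cancel₀ h2
      rw [mul_zero, ← h, Complex.real_smul, Complex.real_smul]
      ring
    have him := congrArg Complex.im h3
    have ht : t = 0 := by simpa [τ.im_ne_zero] using him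
    subst ht
    exact ⟨by simpa using h3, rfl⟩

/-- `g₂ = (2πi)⁴ · 60 ∑' w⁻⁴`, the sum over the nonzero `w ∈ ℤ · 2πi + ℤ · 2πiτ`. -/
def g2 (τ : ℍ) : ℂ := (2 * Real.pi * Complex.I) ^ 4 * (periods τ).g₂

/-- `g₃ = (2πi)⁶ · 140 ∑' w⁻⁶`, the sum over the nonzero `w ∈ ℤ · 2πi + ℤ · 2πiτ`. -/
def g3 (τ : ℍ) : ℂ := (2 * Real.pi * Complex.I) ^ 6 * (periods τ).g₃

/-- The discriminant. -/
def Delta (τ : ℍ) : ℂ := g2 τ ^ 3 - 27 * g3 τ ^ 2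

/-- The `j`-invariant, in the normalization without the factor `1728`. -/
def jInv (τ : ℍ) : ℂ := g2 τ ^ 3 / Delta τ

/-- The value at the `N`-torsion point `2πik/N` of the Weierstrass `℘`-function of the lattice
`ℤ · 2πi + ℤ · 2πiτ`. -/
def pFun (N : ℕ) (k : ℤ) (τ : ℍ) : ℂ :=
  (periods τ).weierstrassP (2 * Real.pi * Complex.I * k / N)

/-- `f_k = g₂ g₃ p_k / Δ`. -/
def fFun (N : ℕ) (k : ℤ) (τ : ℍ) : ℂ := g2 τ * g3 τ * pFun N k τ / Delta τ

end ModularFunctions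

end

/-!
A modular function of level one becomes holomorphic on `ℍ` after multiplication by a nonzero
polynomial in `j`, and a holomorphic one is a modular form of level one divided by a power of the
discriminant, hence a polynomial in `j`. So the field of modular functions of level one is `ℂ(j)`.
The conjugates under `SL(2, ℤ)` of a modular function `h` for a subgroup of finite index are finite
in number, and interpolation along this orbit expresses any `x` with at least the symmetry of `h`
as a value at `h` of a polynomial over `ℂ(j)`.

For `h = f_k` the symmetry is computed from the division values of `℘`: `SL(2, ℤ)` acts on them
through their coordinates, and the expansion of `℘` at `i∞` recovers the coordinates up to sign and
integral translation. Hence the stabilizer of `f_k` is `± Γ₁(N)`.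
-/

noncomputable section

namespace ModularFunctions

open EisensteinSeries ModularForm Polynomial
open scoped Manifold MatrixGroups

/-! ### The action of `SL(2, ℤ)` on meromorphic functions -/

lemma eventually_codiscrete_iff {X : Type*} [TopologicalSpace X] {p : X → Prop} :
    (∀ᶠ x in codiscrete X, p x) ↔ ∀ x, ∀ᶠ y in 𝓝[≠] x, p y := by
  simp only [Filter.Eventually, codiscrete, mem_codiscreteWithin_iff_forall_mem_nhdsNE,
    Set.mem_univ, forall_const, Set.compl_univ, Set.union_empty]

lemma map_coe_nhdsNE (τ : ℍ) : map ((↑) : ℍ → ℂ) (𝓝[≠] τ) = 𝓝[≠] (τ : ℂ) := by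
  rw [isOpenEmbedding_coe.isEmbedding.map_nhdsWithin_eq,
    Set.image_compl_eq_range_sdiff_image isOpenEmbedding_coe.injective, Set.image_singleton,
    Set.sdiff_eq, nhdsWithin_inter_of_mem (mem_nhdsWithin_of_mem_nhds <|
      isOpenEmbedding_coe.isOpen_range.mem_nhds ⟨τ, rfl⟩)]

lemma eventually_nhdsNE_coe_iff {τ : ℍ} {p : ℍ → Prop} :
    (∀ᶠ z in 𝓝[≠] (τ : ℂ), p (ofComplex z)) ↔ ∀ᶠ σ in 𝓝[≠] τ, p σ := by
  simp only [← map_coe_nhdsNE, eventually_map, ofComplex_apply]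

lemma tendsto_smul_nhdsNE (γ : SL(2, ℤ)) (τ : ℍ) :
    Tendsto (fun σ : ℍ => γ • σ) (𝓝[≠] τ) (𝓝[≠] (γ • τ)) :=
  ((Homeomorph.smul (γ : GL (Fin 2) ℝ)).map_punctured_nhds_eq τ).le

lemma tendsto_smul_codiscrete (γ : SL(2, ℤ)) :
    Tendsto (fun σ : ℍ => γ • σ) (codiscrete ℍ) (codiscrete ℍ) := fun s hs => by
  have hs' := eventually_codiscrete_iff.1 (show ∀ᶠ σ in codiscrete ℍ, σ ∈ s from hs)
  exact eventually_codiscrete_iff.2 fun τ => (tendsto_smul_nhdsNE γ τ).eventually (hs' (γ • τ))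

lemma det_coe_GL_pos (γ : SL(2, ℤ)) : 0 < (γ : GL (Fin 2) ℝ).val.det :=
  one_pos.trans_eq (Matrix.SpecialLinearGroup.det_coe (γ : SL(2, ℝ))).symm

lemma IsMeromorphic.comp_smul {f : ℍ → ℂ} (hf : IsMeromorphic f) (γ : SL(2, ℤ)) :
    IsMeromorphic fun τ => f (γ • τ) := fun τ => by
  have hfγ : MeromorphicAt (fun z : ℂ => f (ofComplex z)) ((γ • ofComplex (τ : ℂ) : ℍ) : ℂ) := hf _
  simpa only [Function.comp_def, ofComplex_apply] using
    hfγ.comp_analyticAt (g := fun z => ((γ • ofComplex z : ℍ) : ℂ))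
      (τ.analyticAt_smul (det_coe_GL_pos γ))

lemma toField_eq_iff {f g : ℍ → ℂ} {hf : IsMeromorphic f} {hg : IsMeromorphic g} :
    toField f hf = toField g hg ↔ ∀ᶠ τ in codiscrete ℍ, f τ = g τ := by
  refine Ideal.Quotient.eq.trans ?_
  change (∀ᶠ τ in codiscrete ℍ, f τ - g τ = 0) ↔ _
  simp only [sub_eq_zero]

lemma exists_toField_eq (x : MeromorphicField) : ∃ f hf, toField f hf = x := by
  obtain ⟨⟨f, hf⟩, rfl⟩ := Ideal.Quotient.mk_surjective x
  exact ⟨f, hf, rfl⟩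

/-- Composition with `τ ↦ γ • τ`, as an endomorphism of the field of meromorphic functions. -/
def compField (γ : SL(2, ℤ)) : MeromorphicField →+* MeromorphicField :=
  Ideal.quotientMap (f :=
    { toFun := fun f : meromorphicAlgebra => ⟨fun τ => f.1 (γ • τ), f.2.comp_smul γ⟩
      map_one' := rfl
      map_mul' := fun _ _ => rfl
      map_zero' := rfl
      map_add' := fun _ _ => rfl }) negligibleIdeal fun _ hf =>
    (tendsto_smul_codiscrete γ).eventually hf

/-- `SL(2, ℤ)` acts on the field of meromorphic functions by `(γ • f) τ = f (γ⁻¹ • τ)`; the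
inverse makes this a left action. -/
instance : MulSemiringAction SL(2, ℤ) MeromorphicField where
  smul γ x := compField γ⁻¹ x
  one_smul x := by
    obtain ⟨f, hf, rfl⟩ := exists_toField_eq x
    exact toField_eq_iff.2 (by simp)
  mul_smul γ δ x := by
    obtain ⟨f, hf, rfl⟩ := exists_toField_eq x
    exact (toField_eq_iff (hf := hf.comp_smul _) (hg := (hf.comp_smul _).comp_smul _)).2
      (by simp [mul_smul])
  smul_zero γ := (compField γ⁻¹).map_zero
  smul_add γ := (compField γ⁻¹).map_add
  smul_one γ := (compField γ⁻¹).map_one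
  smul_mul γ := (compField γ⁻¹).map_mul

lemma smul_toField (γ : SL(2, ℤ)) (f : ℍ → ℂ) (hf : IsMeromorphic f) :
    γ • toField f hf = toField (fun τ => f (γ⁻¹ • τ)) (hf.comp_smul γ⁻¹) := rfl

lemma smul_toField_eq_self_iff {γ : SL(2, ℤ)} {f : ℍ → ℂ} {hf : IsMeromorphic f} :
    γ • toField f hf = toField f hf ↔ ∀ᶠ τ in codiscrete ℍ, f (γ⁻¹ • τ) = f τ := by
  rw [smul_toField, toField_eq_iff]

lemma isInvariant_iff_smul_toField {Γ : Subgroup SL(2, ℤ)} {f : ℍ → ℂ} {hf : IsMeromorphic f} :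
    IsInvariant Γ f ↔ ∀ γ ∈ Γ, γ • toField f hf = toField f hf := by
  simp only [smul_toField_eq_self_iff]
  exact ⟨fun h γ hγ => h _ (inv_mem hγ), fun h γ hγ => by simpa using h _ (inv_mem hγ)⟩

lemma neg_smul_meromorphicField (γ : SL(2, ℤ)) (x : MeromorphicField) : -γ • x = γ • x := by
  obtain ⟨f, hf, rfl⟩ := exists_toField_eq x
  have h : (-γ)⁻¹ = -γ⁻¹ := inv_eq_of_mul_eq_one_right (by simp)
  exact toField_eq_iff.2 (by simp [h])

lemma IsMeromorphicAtCusps.congr {N : ℕ} {f g : ℍ → ℂ} (hf : IsMeromorphicAtCusps N f)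
    (h : ∀ᶠ τ in codiscrete ℍ, f τ = g τ) : IsMeromorphicAtCusps N g := fun γ => by
  obtain ⟨G, hG, hfG⟩ := hf γ
  refine ⟨G, hG, ?_⟩
  filter_upwards [hfG, ((tendsto_smul_codiscrete γ).eventually h).filter_mono inf_le_left]
    with τ h₁ h₂
  rw [← h₂, h₁]

lemma toField_mem_modularFunctionField_iff {Γ : Subgroup SL(2, ℤ)} {N : ℕ} {f : ℍ → ℂ}
    {hf : IsMeromorphic f} : toField f hf ∈ modularFunctionField Γ N ↔
      (∀ γ ∈ Γ, γ • toField f hf = toField f hf) ∧ IsMeromorphicAtCusps N f := by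
  refine ⟨?_, fun h => ⟨f, hf, rfl, isInvariant_iff_smul_toField.2 h.1, h.2⟩⟩
  rintro ⟨g, hg, hgf, hinv, hcusp⟩
  rw [← hgf]
  exact ⟨isInvariant_iff_smul_toField.1 hinv, hcusp.congr (toField_eq_iff.1 hgf)⟩

lemma mem_modularFunctionField_iff {Γ : Subgroup SL(2, ℤ)} {N : ℕ} {x : MeromorphicField} :
    x ∈ modularFunctionField Γ N ↔ (∀ γ ∈ Γ, γ • x = x) ∧ x ∈ modularFunctionField ⊥ N := by
  obtain ⟨f, hf, rfl⟩ := exists_toField_eq x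
  simp [toField_mem_modularFunctionField_iff]

lemma smul_mem_modularFunctionField_bot {N : ℕ} {x : MeromorphicField}
    (hx : x ∈ modularFunctionField ⊥ N) (γ : SL(2, ℤ)) :
    γ • x ∈ modularFunctionField ⊥ N := by
  obtain ⟨f, hf, rfl, -, hcusp⟩ := hx
  rw [smul_toField, toField_mem_modularFunctionField_iff]
  refine ⟨by simp, fun δ => ?_⟩
  simpa only [mul_smul] using hcusp (γ⁻¹ * δ)

/-! ### Interpolation on an orbit -/

section Interpolation

variable {G L : Type*} [Group G]

lemma exists_map_smul_eq_of_stabilizer_le {X Y : Type*} [MulAction G X] [MulAction G Y] {x : X}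
    {y : Y} (hst : MulAction.stabilizer G x ≤ MulAction.stabilizer G y) :
    ∃ φ : X → Y, ∀ g : G, φ (g • x) = g • y := by
  have hfac : (fun g : G => g • y).FactorsThrough fun g => g • x := fun g g' h => by
    have hmem : g⁻¹ * g' ∈ MulAction.stabilizer G x := by
      rw [MulAction.mem_stabilizer_iff, mul_smul, inv_smul_eq_iff]
      exact h.symm
    have := MulAction.mem_stabilizer_iff.1 (hst hmem)
    rwa [mul_smul, inv_smul_eq_iff, eq_comm] at this
  exact ⟨_, hfac.extend_apply fun _ => y⟩

variable [Field L]

lemma coeff_interpolate_mem {ι : Type*} [DecidableEq ι] (M : Subfield L) {s : Finset ι}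
    {v r : ι → L} (hv : ∀ i ∈ s, v i ∈ M) (hr : ∀ i ∈ s, r i ∈ M) (n : ℕ) :
    (Lagrange.interpolate s v r).coeff n ∈ M := by
  have hC : ∀ x ∈ M, C x ∈ (mapRingHom M.subtype).range := fun x hx => ⟨C ⟨x, hx⟩, by simp⟩
  have hX : (X : L[X]) ∈ (mapRingHom M.subtype).range := ⟨X, by simp⟩
  have hlift : Lagrange.interpolate s v r ∈ (mapRingHom M.subtype).range := by
    rw [Lagrange.interpolate_apply]
    refine sum_mem fun i hi => mul_mem (hC _ (hr i hi)) (prod_mem fun j hj => ?_)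
    have hvj := hv j (Finset.mem_of_mem_erase hj)
    exact mul_mem (hC _ (inv_mem (sub_mem (hv i hi) hvj))) (sub_mem hX (hC _ hvj))
  obtain ⟨q, hq⟩ := hlift
  rw [← hq, coe_mapRingHom, coeff_map]
  exact (q.coeff n).2

variable [MulSemiringAction G L] [DecidableEq L]

lemma smul_interpolate_id {s : Finset L} {φ : L → L} {g : G} (hs : ∀ y ∈ s, g⁻¹ • y ∈ s)
    (hφ : ∀ y ∈ s, φ (g⁻¹ • y) = g⁻¹ • φ y) :
    g • Lagrange.interpolate s id φ = Lagrange.interpolate s id φ := by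
  refine Lagrange.eq_interpolate_of_eval_eq φ (Set.injOn_id _) ?_ fun y hy => ?_
  · rw [smul_eq_map, degree_map]
    exact Lagrange.degree_interpolate_lt φ (Set.injOn_id _)
  · have := Lagrange.eval_interpolate_at_node (v := id) φ (Set.injOn_id _) (hs y hy)
    rw [id, smul_eval, ← id_eq (g⁻¹ • y), this, hφ y hy, smul_inv_smul]

end Interpolation

theorem exists_polynomial_of_stabilizer_le {G L : Type*} [Group G] [Field L]
    [MulSemiringAction G L] (M : Subfield L) {h f : L} (hhM : ∀ g : G, g • h ∈ M)
    (hfM : ∀ g : G, g • f ∈ M) (hfin : (MulAction.orbit G h).Finite)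
    (hst : MulAction.stabilizer G h ≤ MulAction.stabilizer G f) :
    ∃ p : L[X], p.eval h = f ∧ ∀ n, p.coeff n ∈ M ∧ ∀ g : G, g • p.coeff n = p.coeff n := by
  classical
  obtain ⟨φ, hφ⟩ := exists_map_smul_eq_of_stabilizer_le hst
  have hmem (g : G) : g • h ∈ hfin.toFinset := hfin.mem_toFinset.2 ⟨g, rfl⟩
  have horb : ∀ y ∈ hfin.toFinset, ∃ g : G, g • h = y := fun y hy => hfin.mem_toFinset.1 hy
  refine ⟨Lagrange.interpolate hfin.toFinset id φ, ?_, fun n =>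
    ⟨coeff_interpolate_mem M (fun y hy => ?_) (fun y hy => ?_) n, fun g => ?_⟩⟩
  · have := Lagrange.eval_interpolate_at_node (v := id) φ (Set.injOn_id _) (hmem 1)
    rwa [id, hφ, one_smul, one_smul] at this
  · obtain ⟨g, rfl⟩ := horb y hy
    exact hhM g
  · obtain ⟨g, rfl⟩ := horb y hy
    exact hφ g ▸ hfM g
  · rw [← coeff_smul, smul_interpolate_id (g := g)]
    · intro y hy
      obtain ⟨g', rfl⟩ := horb y hy
      exact mul_smul g⁻¹ g' h ▸ hmem _
    · intro y hy
      obtain ⟨g', rfl⟩ := horb y hy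
      rw [← mul_smul, hφ, hφ, mul_smul]

/-! ### `g₂`, `g₃`, `Δ` and `j` in terms of Eisenstein series -/

lemma coe_latticeEquivProd_symm (τ : ℍ) (m n : ℤ) :
    (((periods τ).latticeEquivProd.symm (n, m) : (periods τ).lattice) : ℂ) =
      2 * Real.pi * Complex.I * (m * τ + n) := by
  rw [PeriodPair.latticeEquiv_symm_apply]
  simp only [periods]
  ring

lemma two_pi_I_pow_mul_G (τ : ℍ) {n : ℕ} (hn : 3 ≤ n) :
    (2 * Real.pi * Complex.I) ^ n * (periods τ).G n = 2 * riemannZeta n * E hn τ := by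
  have hG : ∑' v : Fin 2 → ℤ, eisSummand n v τ =
      (2 * Real.pi * Complex.I) ^ n * (periods τ).G n := by
    rw [PeriodPair.G, ← tsum_mul_left, ← ((Equiv.prodComm ℤ ℤ).trans
      (periods τ).latticeEquivProd.symm.toEquiv).tsum_eq, ← (finTwoArrowEquiv ℤ).tsum_eq]
    refine tsum_congr fun v => ?_
    change ((v 0 : ℂ) * τ + v 1) ^ (-(n : ℤ)) = (2 * Real.pi * Complex.I) ^ n *
      (((((periods τ).latticeEquivProd.symm (v 1, v 0) : (periods τ).lattice)) : ℂ) ^ n)⁻¹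
    rw [coe_latticeEquivProd_symm, zpow_neg, zpow_natCast, mul_pow (2 * Real.pi * Complex.I : ℂ),
      mul_inv, mul_inv_cancel_left₀ (pow_ne_zero n Complex.two_pi_I_ne_zero)]
  rw [← hG, tsum_eisSummand_eq_riemannZeta_mul_eisensteinSeries hn,
    show E hn τ = (1 / 2 : ℂ) • eisensteinSeriesSIF (N := 1) 0 n τ from rfl,
    eisensteinSeriesSIF_apply 0 n τ, smul_eq_mul]
  ring

lemma riemannZeta_six : riemannZeta (6 : ℕ) = (Real.pi : ℂ) ^ 6 / 945 := by
  have h := riemannZeta_two_mul_nat (k := 3) (by norm_num)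
  have hb : _root_.bernoulli 6 = 1 / 42 := by decide +kernel
  norm_num [hb, Nat.factorial] at h
  push_cast
  rw [h]
  ring

lemma g2_eq_smul_E₄ : g2 = ⇑((4 * Real.pi ^ 4 / 3 : ℂ) • E₄) := by
  funext τ
  have hζ : riemannZeta (4 : ℕ) = (Real.pi : ℂ) ^ 4 / 90 := by exact_mod_cast riemannZeta_four
  rw [g2, PeriodPair.g₂, mul_left_comm, two_pi_I_pow_mul_G τ (by norm_num), hζ,
    smul_apply, smul_eq_mul]
  ring

lemma g3_eq_smul_E₆ : g3 = ⇑((8 * Real.pi ^ 6 / 27 : ℂ) • E₆) := by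
  funext τ
  rw [g3, PeriodPair.g₃, mul_left_comm, two_pi_I_pow_mul_G τ (by norm_num), riemannZeta_six,
    smul_apply, smul_eq_mul]
  ring

lemma Delta_eq_smul_discriminant :
    Delta = ⇑(((2 * Real.pi) ^ 12 : ℂ) • CuspForm.discriminant) := by
  funext τ
  simp only [Delta, g2_eq_smul_E₄, g3_eq_smul_E₆, smul_apply, CuspForm.coe_discriminant,
    discriminant_eq_E₄_cube_sub_E₆_sq, smul_eq_mul]
  ring

lemma Delta_ne_zero (τ : ℍ) : Delta τ ≠ 0 := by
  rw [Delta_eq_smul_discriminant, smul_apply, CuspForm.coe_discriminant]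
  exact mul_ne_zero (by norm_num [Real.pi_ne_zero]) (discriminant_ne_zero τ)

lemma jInv_eq (τ : ℍ) : jInv τ = E₄ τ ^ 3 / (1728 * discriminant τ) := by
  have hπ : (Real.pi : ℂ) ≠ 0 := mod_cast Real.pi_ne_zero
  have hΔ := discriminant_ne_zero τ
  simp only [jInv, Delta_eq_smul_discriminant, g2_eq_smul_E₄, smul_apply,
    CuspForm.coe_discriminant, smul_eq_mul]
  field_simp
  ring

lemma isMeromorphic_of_mdifferentiable {f : ℍ → ℂ} (hf : MDiff f) : IsMeromorphic f := fun τ =>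
  ((UpperHalfPlane.mdifferentiable_iff.1 hf).analyticAt
    (isOpen_upperHalfPlaneSet.mem_nhds τ.2)).meromorphicAt

lemma mdifferentiable_g2 : MDiff g2 :=
  g2_eq_smul_E₄ ▸ ModularFormClass.holo _

lemma mdifferentiable_g3 : MDiff g3 :=
  g3_eq_smul_E₆ ▸ ModularFormClass.holo _

lemma mdifferentiable_Delta : MDiff Delta :=
  Delta_eq_smul_discriminant ▸ CuspFormClass.holo _

lemma mdifferentiable_jInv : MDiff jInv := by
  rw [UpperHalfPlane.mdifferentiable_iff]
  exact ((UpperHalfPlane.mdifferentiable_iff.1 mdifferentiable_g2).pow 3).div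
    (UpperHalfPlane.mdifferentiable_iff.1 mdifferentiable_Delta) fun z _ => Delta_ne_zero _

lemma isMeromorphic_jInv : IsMeromorphic jInv :=
  isMeromorphic_of_mdifferentiable mdifferentiable_jInv

lemma slashInvariantForm_smul {F : Type*} [FunLike F ℍ ℂ] {k : ℤ} [SlashInvariantFormClass F 𝒮ℒ k]
    (f : F) (γ : SL(2, ℤ)) (τ : ℍ) : f (γ • τ) = denom γ τ ^ k * f τ :=
  SlashInvariantForm.slash_action_eqn'' (γ := (γ : GL (Fin 2) ℝ)) f
    (MonoidHom.mem_range.2 ⟨γ, rfl⟩) τ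

lemma g2_smul (γ : SL(2, ℤ)) (τ : ℍ) : g2 (γ • τ) = denom γ τ ^ 4 * g2 τ := by
  rw [g2_eq_smul_E₄, slashInvariantForm_smul]
  rfl

lemma g3_smul (γ : SL(2, ℤ)) (τ : ℍ) : g3 (γ • τ) = denom γ τ ^ 6 * g3 τ := by
  rw [g3_eq_smul_E₆, slashInvariantForm_smul]
  rfl

lemma Delta_smul (γ : SL(2, ℤ)) (τ : ℍ) : Delta (γ • τ) = denom γ τ ^ 12 * Delta τ := by
  rw [Delta, Delta, g2_smul, g3_smul]
  ring

lemma jInv_smul (γ : SL(2, ℤ)) (τ : ℍ) : jInv (γ • τ) = jInv τ := by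
  rw [jInv, jInv, g2_smul, Delta_smul, mul_pow, ← pow_mul]
  exact mul_div_mul_left _ _ (pow_ne_zero _ (denom_ne_zero _ τ))

/-! ### Orders of meromorphic functions -/

/-- The order of a meromorphic function on the upper half plane at a point: positive at a zero,
negative at a pole, and `⊤` where the function vanishes identically nearby. -/
def ord (f : ℍ → ℂ) (τ : ℍ) : WithTop ℤ :=
  meromorphicOrderAt (fun z => f (ofComplex z)) τ

section Order

variable {f g : ℍ → ℂ} {τ : ℍ}

lemma ord_congr (h : ∀ᶠ σ in 𝓝[≠] τ, f σ = g σ) : ord f τ = ord g τ :=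
  meromorphicOrderAt_congr (eventually_nhdsNE_coe_iff.2 h)

lemma ord_mul (hf : IsMeromorphic f) (hg : IsMeromorphic g) :
    ord (f * g) τ = ord f τ + ord g τ :=
  meromorphicOrderAt_mul (hf τ) (hg τ)

lemma ord_pow (hf : IsMeromorphic f) (n : ℕ) : ord (f ^ n) τ = n * ord f τ :=
  meromorphicOrderAt_pow (hf τ)

lemma ord_comp_smul (f : ℍ → ℂ) (γ : SL(2, ℤ)) (τ : ℍ) :
    ord (fun σ => f (γ • σ)) τ = ord f (γ • τ) :=
  meromorphicOrderAt_comp_smul (det_coe_GL_pos γ)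

lemma analyticAt_of_mdifferentiable (hf : MDiff f) (τ : ℍ) :
    AnalyticAt ℂ (fun z => f (ofComplex z)) τ :=
  (UpperHalfPlane.mdifferentiable_iff.1 hf).analyticAt (isOpen_upperHalfPlaneSet.mem_nhds τ.2)

lemma ord_nonneg_of_mdifferentiable (hf : MDiff f) (τ : ℍ) : 0 ≤ ord f τ :=
  (analyticAt_of_mdifferentiable hf τ).meromorphicOrderAt_nonneg

lemma ord_pos_of_eq_zero (hf : MDiff f) (hτ : f τ = 0) : 0 < ord f τ := by
  have han := analyticAt_of_mdifferentiable hf τ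
  have htendsto := han.continuousAt.tendsto.mono_left (nhdsWithin_le_nhds (s := {(τ : ℂ)}ᶜ))
  rw [ofComplex_apply, hτ] at htendsto
  exact (tendsto_zero_iff_meromorphicOrderAt_pos han.meromorphicAt).1 htendsto

lemma IsMeromorphic.eventually_ord_nonneg (hf : IsMeromorphic f) (τ : ℍ) :
    ∀ᶠ σ in 𝓝[≠] τ, 0 ≤ ord f σ := by
  have h := (hf τ).eventually_analyticAt
  rw [← map_coe_nhdsNE, eventually_map] at h
  exact h.mono fun _ hσ => hσ.meromorphicOrderAt_nonneg

lemma exists_nat_mul_add_nonneg {a : WithTop ℤ} (b : WithTop ℤ) (ha : 0 < a) :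
    ∃ n : ℕ, 0 ≤ n * a + b := by
  induction b with
  | top => exact ⟨0, by simp⟩
  | coe b =>
    induction a with
    | top => exact ⟨1, by simp⟩
    | coe a =>
      have ha' : 0 < a := mod_cast ha
      refine ⟨b.natAbs, ?_⟩
      have hab : 0 ≤ (b.natAbs : ℤ) * a + b := by
        nlinarith [neg_abs_le b, Int.natCast_natAbs b, abs_nonneg b]
      exact WithTop.coe_le_coe.2 hab

lemma exists_eventually_ord_pow_mul_nonneg (hf : MDiff f) (hτ : f τ = 0) (hg : IsMeromorphic g) :
    ∃ n : ℕ, ∀ᶠ σ in 𝓝 τ, 0 ≤ ord (f ^ n * g) σ := by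
  have hfm := isMeromorphic_of_mdifferentiable hf
  obtain ⟨n, hn⟩ := exists_nat_mul_add_nonneg (ord g τ) (ord_pos_of_eq_zero hf hτ)
  have hfn : IsMeromorphic (f ^ n) := fun σ => (hfm σ).pow n
  have hfg : IsMeromorphic (f ^ n * g) := fun σ => (hfn σ).mul (hg σ)
  refine ⟨n, ?_⟩
  rw [← pure_sup_nhdsNE, eventually_sup, eventually_pure, ord_mul hfn hg, ord_pow hfm]
  exact ⟨hn, hfg.eventually_ord_nonneg τ⟩

lemma IsMeromorphic.exists_mdifferentiable (hf : IsMeromorphic f) (h : ∀ τ, 0 ≤ ord f τ) :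
    ∃ g : ℍ → ℂ, MDiff g ∧ ∀ᶠ τ in codiscrete ℍ, f τ = g τ := by
  have hfU : MeromorphicOn (fun z => f (ofComplex z)) upperHalfPlaneSet := fun z hz => hf ⟨z, hz⟩
  set G := toMeromorphicNFOn (fun z => f (ofComplex z)) upperHalfPlaneSet
  have hGan : ∀ z ∈ upperHalfPlaneSet, AnalyticAt ℂ G z := fun z hz =>
    (meromorphicNFOn_toMeromorphicNFOn _ _ hz).meromorphicOrderAt_nonneg_iff_analyticAt.1 <| by
      rw [meromorphicOrderAt_toMeromorphicNFOn hfU hz]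
      exact h ⟨z, hz⟩
  refine ⟨fun τ => G τ, UpperHalfPlane.mdifferentiable_iff.2 fun z hz => ?_,
    eventually_codiscrete_iff.2 fun τ => eventually_nhdsNE_coe_iff.1 ?_⟩
  · refine ((hGan z hz).differentiableAt.congr_of_eventuallyEq ?_).differentiableWithinAt
    filter_upwards [isOpen_upperHalfPlaneSet.mem_nhds hz] with w hw
    rw [Function.comp, ofComplex_apply_of_im_pos hw]
  · filter_upwards [hfU.toMeromorphicNFOn_eq_self_on_nhdsNE τ.2,
      mem_nhdsWithin_of_mem_nhds (isOpen_upperHalfPlaneSet.mem_nhds τ.2)] with z hz hz0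
    rw [ofComplex_apply_of_im_pos hz0]
    simpa [ofComplex_apply_of_im_pos hz0] using hz.symm

end Order

lemma eq_of_eventually_codiscrete {f g : ℍ → ℂ} (hf : Continuous f) (hg : Continuous g)
    (h : ∀ᶠ τ in codiscrete ℍ, f τ = g τ) : f = g :=
  funext fun τ => ((hf.continuousAt.eventuallyEq_nhds_iff_eventuallyEq_nhdsNE hg.continuousAt).1
    (eventually_codiscrete_iff.1 h τ)).eq_of_nhds

/-! ### Meromorphy at the cusps -/

/-- For `τ` with large imaginary part, `f τ` is a meromorphic function of the local parameter
`exp (2πiτ / N)` at `i∞`, up to a closed discrete set. -/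
def IsMeromorphicAtInfty (N : ℕ) (f : ℍ → ℂ) : Prop :=
  ∃ G : ℂ → ℂ, MeromorphicAt G 0 ∧ ∀ᶠ τ : ℍ in codiscrete ℍ ⊓ atImInfty,
    f τ = G (Complex.exp (2 * Real.pi * Complex.I * τ / N))

lemma isMeromorphicAtCusps_iff {N : ℕ} {f : ℍ → ℂ} :
    IsMeromorphicAtCusps N f ↔ ∀ γ : SL(2, ℤ), IsMeromorphicAtInfty N fun τ => f (γ • τ) :=
  Iff.rfl

lemma qParam_natCast (N : ℕ) (z : ℂ) :
    Function.Periodic.qParam N z = Complex.exp (2 * Real.pi * Complex.I * z / N) := by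
  rw [Function.Periodic.qParam, Complex.ofReal_natCast]

lemma tendsto_qParam_atImInfty {N : ℕ} (hN : 0 < N) :
    Tendsto (fun τ : ℍ => Complex.exp (2 * Real.pi * Complex.I * τ / N)) atImInfty (𝓝[≠] 0) := by
  simpa only [Function.comp_def, qParam_natCast] using
    (Function.Periodic.qParam_tendsto (h := N) (mod_cast hN)).comp tendsto_coe_atImInfty

lemma eventually_nhdsNE_of_codiscrete_inf_atImInfty {p : ℍ → Prop}
    (h : ∀ᶠ τ in codiscrete ℍ ⊓ atImInfty, p τ) : ∀ᶠ τ in atImInfty, ∀ᶠ σ in 𝓝[≠] τ, p σ := by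
  obtain ⟨s, hs, t, ht, hst⟩ := eventually_inf.1 h
  obtain ⟨A, hA⟩ := (atImInfty_mem t).1 ht
  refine (atImInfty_mem _).2 ⟨A + 1, fun τ hτ => ?_⟩
  filter_upwards [eventually_codiscrete_iff.1 (show ∀ᶠ σ in codiscrete ℍ, σ ∈ s from hs) τ,
    mem_nhdsWithin_of_mem_nhds (UpperHalfPlane.continuous_im.continuousAt.eventually_const_lt
      ((lt_add_one A).trans_le hτ))] with σ hσs hσA
  exact hst σ ⟨hσs, hA σ hσA.le⟩

namespace IsMeromorphicAtInfty

variable {N : ℕ} {f g : ℍ → ℂ}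

lemma mul (hf : IsMeromorphicAtInfty N f) (hg : IsMeromorphicAtInfty N g) :
    IsMeromorphicAtInfty N (f * g) := by
  obtain ⟨F, hF, hfF⟩ := hf
  obtain ⟨G, hG, hgG⟩ := hg
  exact ⟨F * G, hF.mul hG, EventuallyEq.mul hfF hgG⟩

lemma inv (hf : IsMeromorphicAtInfty N f) : IsMeromorphicAtInfty N f⁻¹ := by
  obtain ⟨F, hF, hfF⟩ := hf
  exact ⟨F⁻¹, hF.inv, EventuallyEq.inv hfF⟩

lemma div (hf : IsMeromorphicAtInfty N f) (hg : IsMeromorphicAtInfty N g) :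
    IsMeromorphicAtInfty N (f / g) :=
  div_eq_mul_inv f g ▸ hf.mul hg.inv

lemma pow (hf : IsMeromorphicAtInfty N f) (n : ℕ) : IsMeromorphicAtInfty N (f ^ n) := by
  obtain ⟨F, hF, hfF⟩ := hf
  exact ⟨F ^ n, hF.pow n, EventuallyEq.pow_const hfF n⟩

lemma eventually_analyticAt (hN : 0 < N) (hf : IsMeromorphicAtInfty N f) :
    ∃ G : ℂ → ℂ, MeromorphicAt G 0 ∧ ∀ᶠ τ : ℍ in atImInfty,
      AnalyticAt ℂ (fun z : ℂ => G (Complex.exp (2 * Real.pi * Complex.I * z / N))) τ ∧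
      ∀ᶠ σ : ℍ in 𝓝[≠] τ, f σ = G (Complex.exp (2 * Real.pi * Complex.I * σ / N)) := by
  obtain ⟨G, hG, hfG⟩ := hf
  refine ⟨G, hG, ?_⟩
  filter_upwards [(tendsto_qParam_atImInfty hN).eventually hG.eventually_analyticAt,
    eventually_nhdsNE_of_codiscrete_inf_atImInfty hfG] with τ hτ hfτ
  exact ⟨AnalyticAt.fun_comp (g := G) hτ (by fun_prop), hfτ⟩

lemma eventually_ord_nonneg (hN : 0 < N) (hf : IsMeromorphicAtInfty N f) :
    ∀ᶠ τ in atImInfty, 0 ≤ ord f τ := by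
  obtain ⟨G, -, hG⟩ := hf.eventually_analyticAt hN
  filter_upwards [hG] with τ ⟨hτ, hfτ⟩
  rw [ord, meromorphicOrderAt_congr]
  · exact hτ.meromorphicOrderAt_nonneg
  · rw [EventuallyEq, ← map_coe_nhdsNE, eventually_map]
    simpa only [ofComplex_apply] using hfτ

lemma eventually_eq (hN : 0 < N) (hf : Continuous f) (h : IsMeromorphicAtInfty N f) :
    ∃ G : ℂ → ℂ, MeromorphicAt G 0 ∧ ∀ᶠ τ : ℍ in atImInfty,
      f τ = G (Complex.exp (2 * Real.pi * Complex.I * τ / N)) := by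
  obtain ⟨G, hG, h⟩ := h.eventually_analyticAt hN
  refine ⟨G, hG, h.mono fun τ ⟨hτ, hfτ⟩ => ?_⟩
  exact ((hf.continuousAt.eventuallyEq_nhds_iff_eventuallyEq_nhdsNE
    (hτ.continuousAt.comp continuous_coe.continuousAt)).1 hfτ).eq_of_nhds

end IsMeromorphicAtInfty

lemma periodic_comp_ofComplex {f : ℍ → ℂ} {h : ℝ} (hf : ∀ τ, f (h +ᵥ τ) = f τ) :
    Function.Periodic (f ∘ ofComplex) h := fun z => by
  by_cases! hz : 0 < z.im
  · have hz' : 0 < (z + h).im := by simpa using hz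
    rw [Function.comp, Function.comp, ofComplex_apply_of_im_pos hz,
      ofComplex_apply_of_im_pos hz', ← hf ⟨z, hz⟩]
    congr 1
    ext
    exact add_comm _ _
  · have hz' : (z + h).im ≤ 0 := by simpa using hz
    simp only [Function.comp, ofComplex_apply_of_im_nonpos hz, ofComplex_apply_of_im_nonpos hz']

lemma isMeromorphicAtInfty_of_isBoundedAtImInfty {N : ℕ} (hN : 0 < N) {f : ℍ → ℂ} (hf : MDiff f)
    (hper : ∀ τ, f ((N : ℝ) +ᵥ τ) = f τ) (hbdd : IsBoundedAtImInfty f) :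
    IsMeromorphicAtInfty N f := by
  have hN' : (0 : ℝ) < N := mod_cast hN
  have hper' := periodic_comp_ofComplex hper
  refine ⟨cuspFunction N f, (analyticAt_cuspFunction_zero hN' hper' hf hbdd).meromorphicAt,
    Eventually.of_forall fun τ => ?_⟩
  rw [← qParam_natCast, eq_cuspFunction τ hN'.ne' hper']

lemma natCast_mem_strictPeriods (N : ℕ) : (N : ℝ) ∈ (𝒮ℒ).strictPeriods := by
  simpa using ⟨(N : ℤ), by simp⟩

lemma isMeromorphicAtInfty_of_modularForm {F : Type*} [FunLike F ℍ ℂ] {k : ℤ}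
    [ModularFormClass F 𝒮ℒ k] {N : ℕ} (hN : 0 < N) (f : F) : IsMeromorphicAtInfty N f :=
  isMeromorphicAtInfty_of_isBoundedAtImInfty hN (ModularFormClass.holo f)
    (fun τ => SlashInvariantForm.vAdd_apply_of_mem_strictPeriods f τ (natCast_mem_strictPeriods N))
    (ModularFormClass.bdd_at_infty f)

lemma isMeromorphicAtInfty_g2 {N : ℕ} (hN : 0 < N) : IsMeromorphicAtInfty N g2 :=
  g2_eq_smul_E₄ ▸ isMeromorphicAtInfty_of_modularForm hN _

lemma isMeromorphicAtInfty_g3 {N : ℕ} (hN : 0 < N) : IsMeromorphicAtInfty N g3 :=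
  g3_eq_smul_E₆ ▸ isMeromorphicAtInfty_of_modularForm hN _

lemma isMeromorphicAtInfty_Delta {N : ℕ} (hN : 0 < N) : IsMeromorphicAtInfty N Delta :=
  Delta_eq_smul_discriminant ▸ isMeromorphicAtInfty_of_modularForm hN _

lemma isMeromorphicAtInfty_jInv {N : ℕ} (hN : 0 < N) : IsMeromorphicAtInfty N jInv :=
  ((isMeromorphicAtInfty_g2 hN).pow 3).div (isMeromorphicAtInfty_Delta hN)

/-! ### Modular functions of level one -/

lemma mdifferentiable_eval_jInv (p : ℂ[X]) : MDiff fun τ => p.eval (jInv τ) := by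
  rw [UpperHalfPlane.mdifferentiable_iff]
  exact p.differentiable.comp_differentiableOn
    (UpperHalfPlane.mdifferentiable_iff.1 mdifferentiable_jInv)

lemma isMeromorphic_eval_jInv (p : ℂ[X]) : IsMeromorphic fun τ => p.eval (jInv τ) :=
  isMeromorphic_of_mdifferentiable (mdifferentiable_eval_jInv p)

lemma aeval_toField_jInv (p : ℂ[X]) :
    aeval (toField jInv isMeromorphic_jInv) p =
      toField (fun τ => p.eval (jInv τ)) (isMeromorphic_eval_jInv p) := by
  let j : meromorphicAlgebra := ⟨jInv, isMeromorphic_jInv⟩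
  have hval : ((aeval j p : meromorphicAlgebra) : ℍ → ℂ) = fun τ => p.eval (jInv τ) := by
    funext τ
    have h := aeval_algHom_apply ((Pi.evalAlgHom ℂ (fun _ : ℍ => ℂ) τ).comp
      meromorphicAlgebra.val) j p
    refine h.symm.trans ?_
    rw [coe_aeval_eq_eval]
    rfl
  exact (aeval_algHom_apply (Ideal.Quotient.mkₐ ℂ negligibleIdeal) j p).trans
    (congrArg _ (Subtype.ext hval))

lemma qExpansion_E₄_pow_coeff_zero (n : ℕ) : (qExpansion 1 (E₄.pow n)).coeff 0 = 1 := by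
  rw [ModularForm.qExpansion_pow one_pos one_mem_strictPeriods_SL,
    PowerSeries.coeff_zero_eq_constantCoeff, map_pow,
    ← PowerSeries.coeff_zero_eq_constantCoeff_apply, E_qExpansion_coeff_zero _ ⟨2, rfl⟩, one_pow]

lemma exists_jInv_ne (c : ℂ) : ∃ τ, jInv τ ≠ c := by
  by_contra! h
  have hE : (E₄.pow 3 : ℍ → ℂ) = (1728 * c) • (CuspForm.discriminant : ℍ → ℂ) := by
    funext τ
    have hτ := h τ
    rw [jInv_eq, div_eq_iff (mul_ne_zero (by norm_num) (discriminant_ne_zero τ))] at hτ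
    simp only [ModularForm.coe_pow, Pi.pow_apply, Pi.smul_apply, CuspForm.coe_discriminant,
      smul_eq_mul, hτ]
    ring
  have hcoeff := congrArg (fun f => (qExpansion 1 f).coeff 0) hE
  simp only [qExpansion_E₄_pow_coeff_zero] at hcoeff
  rw [ModularForm.qExpansion_smul one_pos one_mem_strictPeriods_SL, PowerSeries.coeff_smul,
    CuspFormClass.qExpansion_coeff_zero _ one_pos one_mem_strictPeriods_SL, smul_zero] at hcoeff
  exact one_ne_zero hcoeff

lemma transcendental_toField_jInv : Transcendental ℂ (toField jInv isMeromorphic_jInv) := by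
  intro halg
  obtain ⟨c, hc⟩ := minpoly.mem_range_of_degree_eq_one ℂ _
    (IsAlgClosed.degree_eq_one_of_irreducible ℂ (minpoly.irreducible halg.isIntegral))
  obtain ⟨τ, hτ⟩ := exists_jInv_ne c
  have hj : ∀ᶠ τ in codiscrete ℍ, jInv τ = c :=
    toField_eq_iff (hg := fun τ => MeromorphicAt.const c (τ : ℂ)).1 hc.symm
  exact hτ (congrFun (eq_of_eventually_codiscrete mdifferentiable_jInv.continuous
    continuous_const hj) τ)

lemma toField_jInv_mem {N : ℕ} (hN : 0 < N) (Γ : Subgroup SL(2, ℤ)) :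
    toField jInv isMeromorphic_jInv ∈ modularFunctionField Γ N := by
  refine ⟨jInv, isMeromorphic_jInv, rfl, fun γ _ => .of_forall (jInv_smul γ),
    isMeromorphicAtCusps_iff.2 fun γ => ?_⟩
  simpa only [jInv_smul] using isMeromorphicAtInfty_jInv hN

lemma exists_polynomial_ord_mul_nonneg {N : ℕ} (hN : 0 < N) {f : ℍ → ℂ} (hf : IsMeromorphic f)
    (hinv : IsInvariant ⊤ f) (hcusp : IsMeromorphicAtInfty N f) :
    ∃ p : ℂ[X], p ≠ 0 ∧ ∀ τ, 0 ≤ ord ((fun τ => p.eval (jInv τ)) * f) τ := by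
  classical
  obtain ⟨A, hA⟩ := (atImInfty_mem _).1 (hcusp.eventually_ord_nonneg hN)
  choose n hn using fun τ => exists_eventually_ord_pow_mul_nonneg (τ := τ)
    (mdifferentiable_eval_jInv (X - C (jInv τ))) (by simp) hf
  obtain ⟨t, -, ht⟩ :=
    (ModularGroup.isCompact_truncatedFundamentalDomain A).elim_nhds_subcover _ fun τ _ => hn τ
  set p : ℂ[X] := ∏ s ∈ t, (X - C (jInv s)) ^ n s with hp
  have hfd : ∀ τ ∈ ModularGroup.fd, 0 ≤ ord ((fun τ => p.eval (jInv τ)) * f) τ := fun τ hτ => by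
    rcases le_total τ.im A with hτA | hτA
    · obtain ⟨s, hs, hτs⟩ := Set.mem_iUnion₂.1 (ht ⟨hτ, hτA⟩)
      have hfactor : (fun τ => p.eval (jInv τ)) * f =
          (fun τ => (∏ s ∈ t.erase s, (X - C (jInv s)) ^ n s).eval (jInv τ)) *
            ((fun τ => (X - C (jInv s)).eval (jInv τ)) ^ n s * f) := by
        funext σ
        simp only [hp, ← Finset.prod_erase_mul t _ hs, eval_mul, eval_pow, Pi.mul_apply,
          Pi.pow_apply, mul_assoc]
      rw [hfactor, ord_mul (isMeromorphic_eval_jInv _)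
        fun σ => ((isMeromorphic_eval_jInv _ σ).pow _).mul (hf σ)]
      exact add_nonneg (ord_nonneg_of_mdifferentiable (mdifferentiable_eval_jInv _) τ) hτs
    · rw [ord_mul (isMeromorphic_eval_jInv p) hf]
      exact add_nonneg (ord_nonneg_of_mdifferentiable (mdifferentiable_eval_jInv p) τ) (hA τ hτA)
  refine ⟨p, Finset.prod_ne_zero_iff.2 fun s _ => pow_ne_zero _ (X_sub_C_ne_zero _), fun τ => ?_⟩
  obtain ⟨γ, hγ⟩ := ModularGroup.exists_smul_mem_fd τ
  refine (hfd _ hγ).trans_eq ((ord_comp_smul _ γ τ).symm.trans (ord_congr ?_))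
  filter_upwards [eventually_codiscrete_iff.1 (hinv γ trivial) τ] with σ hσ
  simp only [Pi.mul_apply, hσ, jInv_smul]

lemma exists_polynomial_mul_toField_eq {N : ℕ} (hN : 0 < N) {x : MeromorphicField}
    (hx : x ∈ modularFunctionField ⊤ N) :
    ∃ p : ℂ[X], p ≠ 0 ∧ ∃ (g : ℍ → ℂ) (hg : MDiff g),
      aeval (toField jInv isMeromorphic_jInv) p * x =
        toField g (isMeromorphic_of_mdifferentiable hg) := by
  obtain ⟨f, hf, rfl, hinv, hcusp⟩ := hx
  obtain ⟨p, hp, hord⟩ := exists_polynomial_ord_mul_nonneg hN hf hinv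
    (by simpa only [one_smul] using isMeromorphicAtCusps_iff.1 hcusp 1)
  have hpf : IsMeromorphic ((fun τ => p.eval (jInv τ)) * f) := fun τ =>
    (isMeromorphic_eval_jInv p τ).mul (hf τ)
  obtain ⟨g, hg, hpg⟩ := hpf.exists_mdifferentiable hord
  exact ⟨p, hp, g, hg, by rw [aeval_toField_jInv]; exact toField_eq_iff (hf := hpf).2 hpg⟩

lemma discriminant_isBigO_qParam {N : ℕ} (hN : 0 < N) :
    discriminant =O[atImInfty] fun τ : ℍ => Complex.exp (2 * Real.pi * Complex.I * τ / N) := by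
  refine (CuspFormClass.exp_decay_atImInfty CuspForm.discriminant (Nat.cast_pos.2 hN)
    (natCast_mem_strictPeriods N)).trans (Asymptotics.isBigO_of_le _ fun τ => ?_)
  rw [Complex.norm_exp, Real.norm_of_nonneg (Real.exp_pos _).le, Real.exp_le_exp]
  simp

lemma IsMeromorphicAtInfty.exists_isBoundedAtImInfty {N : ℕ} (hN : 0 < N) {g : ℍ → ℂ}
    (hg : Continuous g) (hcusp : IsMeromorphicAtInfty N g) :
    ∃ n : ℕ, IsBoundedAtImInfty (g * discriminant ^ n) := by
  obtain ⟨G, ⟨n, hn⟩, hgG⟩ := hcusp.eventually_eq hN hg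
  have hG : (fun z => (z - 0) ^ n • G z) =O[𝓝[≠] 0] (1 : ℂ → ℝ) :=
    (hn.continuousAt.tendsto.isBigO_one ℝ).mono nhdsWithin_le_nhds
  refine ⟨n, ?_⟩
  refine ((EventuallyEq.isBigO hgG).mul ((discriminant_isBigO_qParam hN).pow n)).trans ?_
  refine (hG.comp_tendsto (tendsto_qParam_atImInfty hN)).congr_left fun τ => ?_
  simp only [Function.comp, sub_zero, smul_eq_mul, mul_comm]

/-- Subtracting a multiple of `E₄ ^ (3 n)` from a form of weight `12 n` gives a cusp form, which
is `Δ` times a form of weight `12 (n - 1)`. -/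
lemma exists_polynomial_mul_discriminant_pow (n : ℕ) {k : ℤ} (hk : k = 12 * n)
    (F : ModularForm 𝒮ℒ k) :
    ∃ p : ℂ[X], ∀ τ, F τ = p.eval (jInv τ) * discriminant τ ^ n := by
  induction n generalizing k with
  | zero =>
    obtain rfl : k = 0 := by simpa using hk
    obtain ⟨c, hc⟩ := ModularFormClass.levelOne_weight_zero_const F
    exact ⟨C c, fun τ => by simp [hc]⟩
  | succ n ih =>
    have hw : ((3 * (n + 1) : ℕ) : ℤ) * 4 = k := by
      rw [hk]
      push_cast
      ring
    set P : ModularForm 𝒮ℒ k := ModularForm.mcast hw (E₄.pow (3 * (n + 1))) with hP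
    have hPτ : ∀ τ, P τ = (1728 * jInv τ * discriminant τ) ^ (n + 1) := fun τ => by
      rw [hP, coe_mcast, ModularForm.coe_pow, Pi.pow_apply, pow_mul, jInv_eq]
      congr 1
      field_simp [discriminant_ne_zero τ]
    have hP0 : (qExpansion 1 P).coeff 0 = 1 := by
      rw [hP, coe_mcast, qExpansion_E₄_pow_coeff_zero]
    set c := (qExpansion 1 F).coeff 0
    have hcusp := (isCuspForm_iff_coeffZero_eq_zero _).1 (sub_smul_isCuspForm F P hP0)
    obtain ⟨p, hp⟩ := ih (k := k - 12) (by rw [hk]; push_cast; ring)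
      (CuspForm.discriminantEquiv (toCuspForm _ hcusp))
    refine ⟨C (c * 1728 ^ (n + 1)) * X ^ (n + 1) + p, fun τ => ?_⟩
    have hdiv := discriminant_mul_discriminantEquiv_apply (toCuspForm _ hcusp) τ
    rw [hp, toCuspForm_apply, show (F - c • P) τ = F τ - c * P τ from rfl, hPτ] at hdiv
    simp only [eval_add, eval_mul, eval_C, eval_pow, eval_X]
    linear_combination -hdiv

lemma exists_polynomial_of_isBoundedAtImInfty {g : ℍ → ℂ} (hg : MDiff g)
    (hinv : ∀ (γ : SL(2, ℤ)) τ, g (γ • τ) = g τ) {n : ℕ}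
    (hbdd : IsBoundedAtImInfty (g * discriminant ^ n)) :
    ∃ p : ℂ[X], ∀ τ, g τ = p.eval (jInv τ) := by
  have hslash : ∀ γ : SL(2, ℤ), (g * discriminant ^ n) ∣[(12 * n : ℤ)] γ = g * discriminant ^ n :=
      fun γ => by
    funext τ
    have hΔ := slashInvariantForm_smul CuspForm.discriminant γ τ
    rw [CuspForm.coe_discriminant] at hΔ
    rw [SL_slash_apply, Pi.mul_apply, Pi.mul_apply, Pi.pow_apply, Pi.pow_apply, hinv, hΔ, mul_pow,
      ← zpow_natCast (_ ^ (12 : ℤ)), ← zpow_mul, mul_left_comm, mul_comm (_ ^ _),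
      zpow_neg, mul_inv_cancel_right₀ (zpow_ne_zero _ (denom_ne_zero _ τ))]
  let F : ModularForm 𝒮ℒ (12 * n : ℤ) :=
    { toFun := g * discriminant ^ n
      slash_action_eq' := fun _ ⟨γ, hγ⟩ => hγ ▸ hslash γ
      holo' := hg.mul (CuspForm.discriminant.holo'.pow n)
      bdd_at_cusps' {c} hc := by
        rw [Subgroup.IsArithmetic.isCusp_iff_isCusp_SL2Z] at hc
        rw [OnePoint.isBoundedAt_iff_forall_SL2Z hc]
        intro γ _
        rw [hslash γ]
        exact hbdd }
  obtain ⟨p, hp⟩ := exists_polynomial_mul_discriminant_pow n rfl F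
  exact ⟨p, fun τ => mul_right_cancel₀ (pow_ne_zero n (discriminant_ne_zero τ)) (hp τ)⟩

lemma exists_toField_eq_aeval_jInv {N : ℕ} (hN : 0 < N) {g : ℍ → ℂ} (hg : MDiff g)
    (hx : toField g (isMeromorphic_of_mdifferentiable hg) ∈ modularFunctionField ⊤ N) :
    ∃ p : ℂ[X], toField g (isMeromorphic_of_mdifferentiable hg) =
      aeval (toField jInv isMeromorphic_jInv) p := by
  obtain ⟨hinv, hcusp⟩ := toField_mem_modularFunctionField_iff.1 hx
  have hinv' (γ : SL(2, ℤ)) : ∀ τ, g (γ • τ) = g τ :=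
    congrFun (eq_of_eventually_codiscrete
      (hg.continuous.comp (continuous_const_smul (γ : GL (Fin 2) ℝ))) hg.continuous
      (isInvariant_iff_smul_toField.2 hinv γ trivial))
  obtain ⟨n, hn⟩ := IsMeromorphicAtInfty.exists_isBoundedAtImInfty hN hg.continuous
    (by simpa only [one_smul] using isMeromorphicAtCusps_iff.1 hcusp 1)
  obtain ⟨p, hp⟩ := exists_polynomial_of_isBoundedAtImInfty hg hinv' hn
  exact ⟨p, by rw [aeval_toField_jInv, toField_eq_iff]; exact .of_forall hp⟩

lemma aeval_mem_adjoin_jInv (p : ℂ[X]) : aeval (toField jInv isMeromorphic_jInv) p ∈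
    IntermediateField.adjoin ℂ {toField jInv isMeromorphic_jInv} :=
  IntermediateField.algebra_adjoin_le_adjoin ℂ _ (aeval_mem_adjoin_singleton ℂ _)

theorem modularFunctionField_top {N : ℕ} (hN : 0 < N) :
    modularFunctionField ⊤ N = IntermediateField.adjoin ℂ {toField jInv isMeromorphic_jInv} := by
  have hj : toField jInv isMeromorphic_jInv ∈ modularFunctionField ⊤ N := toField_jInv_mem hN ⊤
  have hle : IntermediateField.adjoin ℂ {toField jInv isMeromorphic_jInv} ≤
      modularFunctionField ⊤ N :=
    IntermediateField.adjoin_le_iff.2 (Set.singleton_subset_iff.2 hj)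
  refine le_antisymm (fun x hx => ?_) hle
  obtain ⟨p, hp, g, hg, hpg⟩ := exists_polynomial_mul_toField_eq hN hx
  obtain ⟨q, hq⟩ := exists_toField_eq_aeval_jInv hN hg
    (hpg ▸ mul_mem (hle (aeval_mem_adjoin_jInv p)) hx)
  have hp0 : aeval (toField jInv isMeromorphic_jInv) p ≠ 0 := fun h =>
    transcendental_toField_jInv ⟨p, hp, h⟩
  rw [(eq_div_iff hp0).2 ((mul_comm _ _).trans (hpg.trans hq))]
  exact div_mem (aeval_mem_adjoin_jInv q) (aeval_mem_adjoin_jInv p)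

/-! ### Fields generated by `j` and one further function -/

lemma finite_orbit_of_mem_modularFunctionField {Γ : Subgroup SL(2, ℤ)} [Γ.FiniteIndex] {N : ℕ}
    {x : MeromorphicField} (hx : x ∈ modularFunctionField Γ N) :
    (MulAction.orbit SL(2, ℤ) x).Finite := by
  have hle : Γ ≤ MulAction.stabilizer SL(2, ℤ) x := (mem_modularFunctionField_iff.1 hx).1
  have : (MulAction.stabilizer SL(2, ℤ) x).FiniteIndex := Subgroup.finiteIndex_of_le hle
  exact (Finite.of_equiv _ (MulAction.orbitEquivQuotientStabilizer SL(2, ℤ) x).symm :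
    Finite (MulAction.orbit SL(2, ℤ) x))

/-- A modular function for `Γ` is a polynomial in `h` with coefficients of level one. -/
theorem adjoin_jInv_eq_modularFunctionField {Γ : Subgroup SL(2, ℤ)} [Γ.FiniteIndex] {N : ℕ}
    (hN : 0 < N) {h : MeromorphicField} (hh : h ∈ modularFunctionField Γ N)
    (hst : ∀ γ : SL(2, ℤ), γ • h = h → γ ∈ Γ ∨ -γ ∈ Γ) :
    IntermediateField.adjoin ℂ {toField jInv isMeromorphic_jInv, h} = modularFunctionField Γ N := by
  refine le_antisymm (IntermediateField.adjoin_le_iff.2 ?_) fun x hx => ?_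
  · exact Set.pair_subset (toField_jInv_mem hN Γ) hh
  have hstab : MulAction.stabilizer SL(2, ℤ) h ≤ MulAction.stabilizer SL(2, ℤ) x := fun γ hγ => by
    have hΓx := (mem_modularFunctionField_iff.1 hx).1
    rcases hst γ hγ with hΓ | hΓ
    · exact hΓx γ hΓ
    · exact (neg_smul_meromorphicField γ x).symm.trans (hΓx _ hΓ)
  have hbot {y} (hy : y ∈ modularFunctionField Γ N) (γ : SL(2, ℤ)) :
      γ • y ∈ (modularFunctionField ⊥ N).toSubfield :=
    smul_mem_modularFunctionField_bot (mem_modularFunctionField_iff.1 hy).2 γ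
  obtain ⟨p, rfl, hp⟩ := exists_polynomial_of_stabilizer_le _ (hbot hh) (hbot hx)
    (finite_orbit_of_mem_modularFunctionField hh) hstab
  have hcoeff (n : ℕ) : p.coeff n ∈ IntermediateField.adjoin ℂ {toField jInv isMeromorphic_jInv} :=
    modularFunctionField_top hN ▸ mem_modularFunctionField_iff.2 ⟨fun γ _ => (hp n).2 γ, (hp n).1⟩
  rw [eval_eq_sum]
  exact sum_mem fun n _ => mul_mem (IntermediateField.adjoin.mono ℂ _ _ (by simp) (hcoeff n))
    (pow_mem (IntermediateField.subset_adjoin ℂ _ (by simp)) n)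

/-! ### The function `q / (1 - q) ^ 2` -/

open Complex (integerComplement)

/-- The function `q / (1 - q) ^ 2` of `q = exp (2πiz)`. Up to the factor `(2πi) ^ 2` it is the sum
of `1 / (z + n) ^ 2` over all integers `n`. -/
def qFrac (z : ℂ) : ℂ :=
  Complex.exp (2 * Real.pi * Complex.I * z) / (1 - Complex.exp (2 * Real.pi * Complex.I * z)) ^ 2

lemma exp_two_pi_I_mul_eq_one_iff {z : ℂ} :
    Complex.exp (2 * Real.pi * Complex.I * z) = 1 ↔ z ∉ integerComplement := by
  rw [Complex.exp_eq_one_iff, integerComplement, Set.notMem_compl_iff]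
  refine exists_congr fun n => ?_
  rw [mul_comm (n : ℂ), mul_right_inj' Complex.two_pi_I_ne_zero, eq_comm]

lemma one_sub_exp_ne_zero {z : ℂ} (hz : z ∈ integerComplement) :
    1 - Complex.exp (2 * Real.pi * Complex.I * z) ≠ 0 := fun h =>
  exp_two_pi_I_mul_eq_one_iff.1 (sub_eq_zero.1 h).symm hz

lemma qFrac_ne_zero {z : ℂ} (hz : z ∈ integerComplement) : qFrac z ≠ 0 :=
  div_ne_zero (Complex.exp_ne_zero _) (pow_ne_zero _ (one_sub_exp_ne_zero hz))

lemma differentiableAt_qFrac {z : ℂ} (hz : z ∈ integerComplement) : DifferentiableAt ℂ qFrac z :=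
  .fun_div (by fun_prop) (by fun_prop) (pow_ne_zero _ (one_sub_exp_ne_zero hz))

lemma qFrac_neg (z : ℂ) : qFrac (-z) = qFrac z := by
  have hq := Complex.exp_ne_zero (2 * Real.pi * Complex.I * z)
  rw [qFrac, qFrac, mul_neg, Complex.exp_neg]
  generalize Complex.exp (2 * Real.pi * Complex.I * z) = q at *
  have hsub : 1 - q⁻¹ = -(1 - q) / q := by
    field_simp
    ring
  rw [hsub, div_pow, neg_sq, div_div_eq_mul_div]
  congr 1
  field_simp

lemma sub_or_add_notMem_of_qFrac_eq {z w : ℂ} (hz : z ∈ integerComplement)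
    (hw : w ∈ integerComplement) (h : qFrac z = qFrac w) :
    z - w ∉ integerComplement ∨ z + w ∉ integerComplement := by
  rw [qFrac, qFrac, div_eq_div_iff (pow_ne_zero _ (one_sub_exp_ne_zero hz))
    (pow_ne_zero _ (one_sub_exp_ne_zero hw))] at h
  rw [← exp_two_pi_I_mul_eq_one_iff, ← exp_two_pi_I_mul_eq_one_iff, mul_sub, mul_add,
    Complex.exp_sub, Complex.exp_add, div_eq_one_iff_eq (Complex.exp_ne_zero _)]
  generalize Complex.exp (2 * Real.pi * Complex.I * z) = q at *
  generalize Complex.exp (2 * Real.pi * Complex.I * w) = r at *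
  have hfactor : (q - r) * (q * r - 1) = 0 := by linear_combination -h
  exact (mul_eq_zero.1 hfactor).imp sub_eq_zero.1 sub_eq_zero.1

lemma norm_exp_two_pi_I_mul (z : ℂ) :
    ‖Complex.exp (2 * Real.pi * Complex.I * z)‖ = Real.exp (-(2 * Real.pi * z.im)) := by
  rw [Complex.norm_exp]
  simp

lemma norm_qFrac_le {ε : ℝ} (hε : 0 < ε) {z : ℂ} (hz : ε ≤ |z.im|) :
    ‖qFrac z‖ ≤ Real.exp (-(2 * Real.pi * |z.im|)) / (1 - Real.exp (-(2 * Real.pi * ε))) ^ 2 := by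
  wlog him : 0 ≤ z.im generalizing z
  · simpa [qFrac_neg] using this (z := -z) (by simpa using hz) (by simpa using (not_le.1 him).le)
  rw [abs_of_nonneg him] at hz ⊢
  have hε1 : Real.exp (-(2 * Real.pi * ε)) < 1 :=
    Real.exp_lt_one_iff.2 (neg_neg_of_pos (by positivity))
  have hsub : 1 - Real.exp (-(2 * Real.pi * ε)) ≤
      ‖1 - Complex.exp (2 * Real.pi * Complex.I * z)‖ := by
    refine le_trans ?_ (norm_sub_norm_le _ _)
    rw [norm_one, norm_exp_two_pi_I_mul]
    gcongr
  rw [qFrac, norm_div, norm_pow, norm_exp_two_pi_I_mul]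
  have := sub_pos.2 hε1
  gcongr

lemma tendsto_qFrac {α : Type*} {l : Filter α} {w : α → ℂ}
    (hw : Tendsto (fun i => |(w i).im|) l atTop) : Tendsto (fun i => qFrac (w i)) l (𝓝 0) := by
  have hexp : Tendsto (fun i => Real.exp (-(2 * Real.pi * |(w i).im|))) l (𝓝 0) :=
    Real.tendsto_exp_neg_atTop_nhds_zero.comp (hw.const_mul_atTop Real.two_pi_pos)
  have hbound := hexp.div_const ((1 - Real.exp (-(2 * Real.pi * 1))) ^ 2)
  rw [zero_div] at hbound
  refine squeeze_zero_norm' ?_ hbound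
  filter_upwards [hw.eventually_ge_atTop 1] with i hi using norm_qFrac_le one_pos hi

lemma summable_one_div_add_int_sq (z : ℂ) : Summable fun n : ℤ => 1 / (z + n) ^ 2 := by
  refine (EisensteinSeries.linear_right_summable z 1 (k := 2) le_rfl).congr fun n => ?_
  rw [Int.cast_one, one_mul, one_div]
  norm_cast

lemma tsum_one_div_add_int_sq_of_im_pos {z : ℂ} (hz : 0 < z.im) :
    ∑' n : ℤ, 1 / (z + n) ^ 2 = (2 * Real.pi * Complex.I) ^ 2 * qFrac z := by
  have hq : ‖Complex.exp (2 * Real.pi * Complex.I * z)‖ < 1 := by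
    rw [norm_exp_two_pi_I_mul]
    exact Real.exp_lt_one_iff.2 (neg_neg_of_pos (by positivity))
  have h := EisensteinSeries.qExpansion_identity (k := 1) le_rfl ⟨z, hz⟩
  simp only [pow_one] at h
  rw [tsum_coe_mul_geometric_of_norm_lt_one hq] at h
  refine h.trans ?_
  simp [qFrac]

lemma tendsto_tsum_one_div_add_int_sq {z : ℂ} (hz : z ∈ integerComplement) (hz0 : z.im = 0) :
    Tendsto (fun ε : ℝ => ∑' n : ℤ, 1 / (z + ε * Complex.I + n) ^ 2) (𝓝 0)
      (𝓝 (∑' n : ℤ, 1 / (z + n) ^ 2)) := by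
  have hne (n : ℤ) : z + n ≠ 0 := Complex.integerComplement_add_ne_zero hz n
  refine tendsto_tsum_of_dominated_convergence (summable_one_div_add_int_sq z).norm (fun n => ?_)
    (.of_forall fun ε n => ?_)
  · have hcont : ContinuousAt (fun ε : ℝ => 1 / (z + ε * Complex.I + n) ^ 2) 0 :=
      .div (by fun_prop) (by fun_prop) (by simpa using hne n)
    simpa using hcont.tendsto
  · have hreal : z + n = ((z + ε * Complex.I + n).re : ℝ) := Complex.ext (by simp) (by simp [hz0])
    have hle : ‖z + n‖ ≤ ‖z + ε * Complex.I + n‖ := by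
      rw [hreal, Complex.norm_real]
      exact Complex.abs_re_le_norm _
    have hpos := norm_pos_iff.2 (hne n)
    rw [norm_div, norm_div, norm_pow, norm_pow]
    gcongr

/-- The partial fraction expansion of `π ^ 2 / sin (π z) ^ 2`; on the real axis it follows from the
upper half plane by continuity. -/
theorem hasSum_one_div_add_int_sq {z : ℂ} (hz : z ∈ integerComplement) :
    HasSum (fun n : ℤ => 1 / (z + n) ^ 2) ((2 * Real.pi * Complex.I) ^ 2 * qFrac z) := by
  rw [(summable_one_div_add_int_sq z).hasSum_iff]
  rcases lt_trichotomy z.im 0 with him | him | him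
  · rw [← qFrac_neg, ← tsum_one_div_add_int_sq_of_im_pos (by simpa using him), ← tsum_comp_neg]
    refine tsum_congr fun n => ?_
    rw [Int.cast_neg, ← neg_sq, neg_add, neg_neg]
  · have hcont : ContinuousAt (fun ε : ℝ => qFrac (z + ε * Complex.I)) 0 :=
      .comp (g := qFrac) (by simpa using (differentiableAt_qFrac hz).continuousAt) (by fun_prop)
    have hlim : Tendsto (fun ε : ℝ => (2 * Real.pi * Complex.I) ^ 2 * qFrac (z + ε * Complex.I))
        (𝓝[>] 0) (𝓝 ((2 * Real.pi * Complex.I) ^ 2 * qFrac z)) := by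
      simpa using (hcont.tendsto.mono_left nhdsWithin_le_nhds).const_mul _
    refine tendsto_nhds_unique (((tendsto_tsum_one_div_add_int_sq hz him).mono_left
      nhdsWithin_le_nhds).congr' ?_) hlim
    filter_upwards [self_mem_nhdsWithin] with ε hε
    exact tsum_one_div_add_int_sq_of_im_pos (by simpa [him] using hε)
  · exact tsum_one_div_add_int_sq_of_im_pos him

lemma hasSum_one_div_int_sq :
    HasSum (fun n : ℤ => 1 / (n : ℂ) ^ 2) ((2 * Real.pi * Complex.I) ^ 2 * (-1 / 12)) := by
  have hsum : Summable fun n : ℤ => 1 / (n : ℂ) ^ 2 := by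
    simpa only [zero_add] using summable_one_div_add_int_sq 0
  have hzeta := two_mul_riemannZeta_eq_tsum_int_inv_pow_of_even (k := 2) le_rfl even_two
  rw [hsum.hasSum_iff]
  simp only [one_div]
  rw [← hzeta, Nat.cast_ofNat, riemannZeta_two, mul_pow, Complex.I_sq]
  ring

/-! ### Division values of `℘` -/

/-- The value of `℘` at the point of `ℂ / L_τ` with real coordinates `(x, y)` in the basis
`2πiτ`, `2πi`. -/
def divisionP (x y : ℝ) (τ : ℍ) : ℂ :=
  (periods τ).weierstrassP (2 * Real.pi * Complex.I * (x * τ + y))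

lemma divisionP_add_intCast (x y : ℝ) (m n : ℤ) : divisionP (x + m) (y + n) = divisionP x y := by
  funext τ
  rw [divisionP, divisionP, ← (periods τ).weierstrassP_add_coe
    (2 * Real.pi * Complex.I * (x * τ + y)) ((periods τ).latticeEquivProd.symm (n, m)),
    coe_latticeEquivProd_symm]
  congr 1
  push_cast
  ring

lemma divisionP_fract_left (x y : ℝ) : divisionP (Int.fract x) y = divisionP x y := by
  rw [← divisionP_add_intCast (Int.fract x) y ⌊x⌋ 0, Int.fract_add_floor, Int.cast_zero, add_zero]

lemma hasSum_weierstrassP_periods (τ : ℍ) (u : ℂ) :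
    HasSum (fun v : ℤ × ℤ => 1 / (u - (v.1 * τ + v.2)) ^ 2 - 1 / ((v.1 : ℂ) * τ + v.2) ^ 2)
      ((2 * Real.pi * Complex.I) ^ 2 *
        (periods τ).weierstrassP (2 * Real.pi * Complex.I * u)) := by
  have h := ((Equiv.prodComm ℤ ℤ).trans (periods τ).latticeEquivProd.symm.toEquiv).hasSum_iff.2
    ((periods τ).hasSum_weierstrassP (2 * Real.pi * Complex.I * u))
  refine (h.mul_left ((2 * Real.pi * Complex.I) ^ 2)).congr_fun fun v => ?_
  change _ = _ * (1 / (_ - (((periods τ).latticeEquivProd.symm (v.2, v.1) :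
    (periods τ).lattice) : ℂ)) ^ 2 - 1 / (((periods τ).latticeEquivProd.symm (v.2, v.1) :
    (periods τ).lattice) : ℂ) ^ 2)
  have hI : (2 * Real.pi * Complex.I : ℂ) ≠ 0 := Complex.two_pi_I_ne_zero
  rw [coe_latticeEquivProd_symm, ← mul_sub, mul_pow _ (u - _), mul_pow _ (_ + _), mul_sub,
    mul_one_div, mul_one_div, div_mul_cancel_left₀ (pow_ne_zero 2 hI),
    div_mul_cancel_left₀ (pow_ne_zero 2 hI), one_div, one_div]

/-- Right multiplication by `γ` on row vectors. -/
def vecMulEquiv (γ : SL(2, ℤ)) : ℤ × ℤ ≃ ℤ × ℤ where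
  toFun v := (v.1 * γ 0 0 + v.2 * γ 1 0, v.1 * γ 0 1 + v.2 * γ 1 1)
  invFun v := (v.1 * γ 1 1 - v.2 * γ 1 0, -v.1 * γ 0 1 + v.2 * γ 0 0)
  left_inv v := by
    have hdet : γ 0 0 * γ 1 1 - γ 0 1 * γ 1 0 = 1 := (Matrix.det_fin_two γ.1).symm.trans γ.2
    ext
    · linear_combination v.1 * hdet
    · linear_combination v.2 * hdet
  right_inv v := by
    have hdet : γ 0 0 * γ 1 1 - γ 0 1 * γ 1 0 = 1 := (Matrix.det_fin_two γ.1).symm.trans γ.2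
    ext
    · linear_combination v.1 * hdet
    · linear_combination v.2 * hdet

lemma mul_coe_smul_add (γ : SL(2, ℤ)) (τ : ℍ) (x y : ℂ) :
    x * ((γ • τ : ℍ) : ℂ) + y =
      ((x * γ 0 0 + y * γ 1 0) * τ + (x * γ 0 1 + y * γ 1 1)) / denom γ τ := by
  have hdenom : denom γ τ ≠ 0 := denom_ne_zero γ τ
  rw [specialLinearGroup_apply, ModularGroup.denom_apply] at *
  simp only [algebraMap_int_eq, eq_intCast, Complex.ofReal_intCast] at *
  rw [eq_div_iff hdenom, add_mul, mul_assoc, div_mul_cancel₀ _ hdenom]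
  ring

lemma divisionP_smul (x y : ℝ) (γ : SL(2, ℤ)) (τ : ℍ) :
    divisionP x y (γ • τ) = denom γ τ ^ 2 *
      divisionP (x * γ 0 0 + y * γ 1 0) (x * γ 0 1 + y * γ 1 1) τ := by
  have hscale (A B D : ℂ) : 1 / (A / D - B / D) ^ 2 - 1 / (B / D) ^ 2 =
      D ^ 2 * (1 / (A - B) ^ 2 - 1 / B ^ 2) := by
    rw [← sub_div, div_pow, div_pow, one_div_div, one_div_div]
    ring
  apply mul_left_cancel₀ (pow_ne_zero 2 Complex.two_pi_I_ne_zero)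
  rw [mul_left_comm, divisionP, divisionP, ← (hasSum_weierstrassP_periods _ _).tsum_eq,
    ← (hasSum_weierstrassP_periods _ _).tsum_eq, ← tsum_mul_left]
  refine Eq.trans (tsum_congr fun v => ?_) ((vecMulEquiv γ).tsum_eq _)
  rw [mul_coe_smul_add γ τ v.1 v.2, mul_coe_smul_add γ τ x y, hscale]
  simp only [vecMulEquiv, Equiv.coe_fn_mk]
  push_cast
  rfl

/-- The contribution of the periods `2πi(mz + n)`, `n ∈ ℤ`, to the expansion of `℘(2πiu)`. The row
`m = 0` is excluded since it contributes the leading term `1 / 12 + qFrac u`. -/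
def rowTerm (m : ℤ) (z u : ℂ) : ℂ :=
  if m = 0 then 0 else qFrac (u - m * z) - qFrac (m * z)

lemma mem_integerComplement_of_im_ne_zero {z : ℂ} (hz : z.im ≠ 0) : z ∈ integerComplement := by
  rintro ⟨n, rfl⟩
  exact hz (Complex.intCast_im n)

lemma intCast_mul_mem_integerComplement {m : ℤ} (hm : m ≠ 0) {z : ℂ} (hz : 0 < z.im) :
    m * z ∈ integerComplement :=
  mem_integerComplement_of_im_ne_zero (by simp [hm, hz.ne'])

lemma im_intCast_mul (m : ℤ) (z : ℂ) : (m * z : ℂ).im = m * z.im := by simp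

lemma mul_abs_le_abs_im_sub {c : ℝ} (hc : c ≤ 1) {m : ℤ} (hm : m ≠ 0) {z u : ℂ} (hz : 0 < z.im)
    (hu : |u.im| ≤ (1 - c) * z.im) : c * z.im * |(m : ℝ)| ≤ |(u - m * z).im| := by
  have hm1 : 1 ≤ |(m : ℝ)| := mod_cast Int.one_le_abs hm
  have htri : |(m : ℝ)| * z.im - |u.im| ≤ |(u - m * z).im| := by
    rw [← abs_of_pos hz, ← abs_mul, Complex.sub_im, im_intCast_mul, abs_sub_comm]
    exact abs_sub_abs_le_abs_sub _ _
  nlinarith [mul_nonneg (mul_nonneg (sub_nonneg.2 hc) (sub_nonneg.2 hm1)) hz.le]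

lemma sub_intCast_mul_mem_integerComplement {z u : ℂ} (hu : u ∈ integerComplement)
    (hz : |u.im| < z.im) (m : ℤ) : u - m * z ∈ integerComplement := by
  rcases eq_or_ne m 0 with rfl | hm
  · simpa using hu
  have hm1 : 1 ≤ |(m : ℝ)| := mod_cast Int.one_le_abs hm
  have hz0 := (abs_nonneg _).trans_lt hz
  refine mem_integerComplement_of_im_ne_zero fun h => ?_
  rw [Complex.sub_im, im_intCast_mul, sub_eq_zero] at h
  rw [h, abs_mul, abs_of_pos hz0] at hz
  nlinarith

lemma hasSum_row {z u : ℂ} (hu : u ∈ integerComplement) (hz : |u.im| < z.im) (m : ℤ) :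
    HasSum (fun n : ℤ => 1 / (u - (m * z + n)) ^ 2 - 1 / ((m : ℂ) * z + n) ^ 2)
      ((2 * Real.pi * Complex.I) ^ 2 *
        (rowTerm m z u + if m = 0 then 1 / 12 + qFrac u else 0)) := by
  have hpole : HasSum (fun n : ℤ => 1 / (u - (m * z + n)) ^ 2)
      ((2 * Real.pi * Complex.I) ^ 2 * qFrac (u - m * z)) := by
    refine ((Equiv.neg ℤ).hasSum_iff.2 (hasSum_one_div_add_int_sq
      (sub_intCast_mul_mem_integerComplement hu hz m))).congr_fun fun n => ?_
    rw [Function.comp, Equiv.neg_apply, Int.cast_neg, ← sub_eq_add_neg, sub_sub]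
  by_cases hm : m = 0
  · subst hm
    simp only [rowTerm, if_true, Int.cast_zero, zero_mul, zero_add, sub_zero] at hpole ⊢
    convert! hpole.sub hasSum_one_div_int_sq using 1
    ring
  · simp only [rowTerm, if_neg hm, add_zero]
    rw [mul_sub]
    exact hpole.sub (hasSum_one_div_add_int_sq
      (intCast_mul_mem_integerComplement hm ((abs_nonneg _).trans_lt hz)))

lemma weierstrassP_periods_eq (τ : ℍ) {u : ℂ} (hu : u ∈ integerComplement) (hτ : |u.im| < τ.im) :
    (periods τ).weierstrassP (2 * Real.pi * Complex.I * u) =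
      1 / 12 + qFrac u + ∑' m, rowTerm m τ u := by
  have hsum := (hasSum_mul_left_iff (pow_ne_zero 2 Complex.two_pi_I_ne_zero)).1
    ((hasSum_weierstrassP_periods τ u).prod_fiberwise (hasSum_row hu hτ))
  have hrows := hsum.sub (hasSum_ite_eq (0 : ℤ) (1 / 12 + qFrac u))
  simp only [add_sub_cancel_right] at hrows
  rw [hrows.tsum_eq, add_sub_cancel]

lemma summable_exp_neg_mul_abs {a : ℝ} (ha : 0 < a) :
    Summable fun m : ℤ => Real.exp (-(a * |(m : ℝ)|)) := by
  rw [summable_int_iff_summable_nat_and_neg]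
  simp only [Int.cast_neg, abs_neg, Int.cast_natCast, Nat.abs_cast, and_self]
  exact (Real.summable_exp_nat_mul_iff.2 (neg_neg_of_pos ha)).congr fun n => by
    rw [mul_neg, mul_comm]

lemma norm_qFrac_le_of_mul_abs_le {ε : ℝ} (hε : 0 < ε) {m : ℤ} (hm : m ≠ 0) {w : ℂ}
    (hw : ε * |(m : ℝ)| ≤ |w.im|) :
    ‖qFrac w‖ ≤
      Real.exp (-(2 * Real.pi * ε * |(m : ℝ)|)) / (1 - Real.exp (-(2 * Real.pi * ε))) ^ 2 := by
  have hm1 : 1 ≤ |(m : ℝ)| := mod_cast Int.one_le_abs hm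
  refine (norm_qFrac_le hε ((le_mul_of_one_le_right hε.le hm1).trans hw)).trans ?_
  rw [mul_assoc _ ε]
  gcongr

lemma exists_summable_norm_rowTerm_le {c δ : ℝ} (hc0 : 0 < c) (hc1 : c ≤ 1) (hδ : 0 < δ) :
    ∃ b : ℤ → ℝ, Summable b ∧ ∀ (m : ℤ) (z u : ℂ), δ ≤ z.im → |u.im| ≤ (1 - c) * z.im →
      ‖rowTerm m z u‖ ≤ b m := by
  have hε : 0 < c * δ := mul_pos hc0 hδ
  have hsum := (summable_exp_neg_mul_abs (mul_pos Real.two_pi_pos hε)).div_const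
    ((1 - Real.exp (-(2 * Real.pi * (c * δ)))) ^ 2)
  refine ⟨_, hsum.add hsum, fun m z u hz hu => ?_⟩
  have hz0 : 0 < z.im := hδ.trans_le hz
  rw [rowTerm]
  split_ifs with hm
  · rw [norm_zero]
    positivity
  have hnumerator : c * δ * |(m : ℝ)| ≤ |(u - m * z).im| :=
    le_trans (by gcongr) (mul_abs_le_abs_im_sub hc1 hm hz0 hu)
  have hperiod : c * δ * |(m : ℝ)| ≤ |(m * z : ℂ).im| := by
    rw [im_intCast_mul, abs_mul, abs_of_pos hz0, mul_comm]
    gcongr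
    exact (mul_le_of_le_one_left hδ.le hc1).trans hz
  exact norm_sub_le_of_le (norm_qFrac_le_of_mul_abs_le hε hm hnumerator)
    (norm_qFrac_le_of_mul_abs_le hε hm hperiod)

section Coordinates

variable {x y : ℝ}

lemma abs_im_ofReal_mul_add {z : ℂ} (hz : 0 < z.im) : |(x * z + y : ℂ).im| = |x| * z.im := by
  rw [Complex.add_im, Complex.im_ofReal_mul, Complex.ofReal_im, add_zero, abs_mul, abs_of_pos hz]

lemma tendsto_im_atImInfty : Tendsto UpperHalfPlane.im atImInfty atTop := tendsto_comap

lemma tendsto_rowTerm (hx : |x| < 1) (y : ℝ) (m : ℤ) :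
    Tendsto (fun τ : ℍ => rowTerm m τ (x * τ + y)) atImInfty (𝓝 0) := by
  unfold rowTerm
  split_ifs with hm
  · exact tendsto_const_nhds
  have hm0 : 0 < |(m : ℝ)| := by positivity
  have hpole : Tendsto (fun τ : ℍ => qFrac (x * τ + y - m * τ)) atImInfty (𝓝 0) := by
    refine tendsto_qFrac (tendsto_atTop_mono (fun τ => mul_abs_le_abs_im_sub
      (sub_le_self 1 (abs_nonneg x)) hm τ.im_pos ?_)
      ((tendsto_im_atImInfty.const_mul_atTop (sub_pos.2 hx)).atTop_mul_const hm0))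
    rw [abs_im_ofReal_mul_add τ.im_pos, sub_sub_cancel]
  have hperiod : Tendsto (fun τ : ℍ => qFrac (m * τ)) atImInfty (𝓝 0) := by
    refine tendsto_qFrac ((tendsto_im_atImInfty.const_mul_atTop hm0).congr fun τ => ?_)
    rw [im_intCast_mul, abs_mul]
    exact congrArg _ (abs_of_pos τ.im_pos).symm
  simpa only [sub_zero] using hpole.sub hperiod

lemma tendsto_tsum_rowTerm (hx : |x| < 1) (y : ℝ) :
    Tendsto (fun τ : ℍ => ∑' m, rowTerm m τ (x * τ + y)) atImInfty (𝓝 0) := by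
  obtain ⟨b, hb, hle⟩ := exists_summable_norm_rowTerm_le (sub_pos.2 hx)
    (sub_le_self 1 (abs_nonneg x)) one_pos
  rw [← tsum_zero (α := ℂ) (β := ℤ) (L := .unconditional ℤ)]
  refine tendsto_tsum_of_dominated_convergence hb (tendsto_rowTerm hx y) ?_
  filter_upwards [(atImInfty_mem _).2 ⟨1, fun _ h => h⟩] with τ hτ m
  exact hle m τ _ hτ (by rw [abs_im_ofReal_mul_add τ.im_pos, sub_sub_cancel])

variable (hx : |x| < 1) (hxy : ¬(Int.fract x = 0 ∧ Int.fract y = 0))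
include hx hxy

lemma ofReal_mul_add_mem_integerComplement {z : ℂ} (hz : 0 < z.im) :
    (x * z + y : ℂ) ∈ integerComplement := by
  rintro ⟨n, hn⟩
  have hx0 : x = 0 := by simpa [hz.ne'] using congrArg Complex.im hn
  subst hx0
  have hy : (n : ℝ) = y := by exact_mod_cast (show (n : ℂ) = y by simpa using hn)
  exact hxy ⟨Int.fract_zero, hy ▸ Int.fract_intCast n⟩

lemma divisionP_eq (τ : ℍ) :
    divisionP x y τ = 1 / 12 + qFrac (x * τ + y) + ∑' m, rowTerm m τ (x * τ + y) :=
  weierstrassP_periods_eq τ (ofReal_mul_add_mem_integerComplement hx hxy τ.im_pos) (by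
    rw [abs_im_ofReal_mul_add τ.im_pos]
    exact mul_lt_of_lt_one_left τ.im_pos hx)

lemma differentiableAt_rowTerm (m : ℤ) {z : ℂ} (hz : 0 < z.im) :
    DifferentiableAt ℂ (fun w => rowTerm m w (x * w + y)) z := by
  unfold rowTerm
  split_ifs with hm
  · exact differentiableAt_const _
  have hlt : |(x * z + y : ℂ).im| < z.im := by
    rw [abs_im_ofReal_mul_add hz]
    exact mul_lt_of_lt_one_left hz hx
  have hpole := sub_intCast_mul_mem_integerComplement
    (ofReal_mul_add_mem_integerComplement hx hxy hz) hlt m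
  exact ((differentiableAt_qFrac hpole).fun_comp' z (by fun_prop)).sub
    ((differentiableAt_qFrac (intCast_mul_mem_integerComplement hm hz)).fun_comp' z (by fun_prop))

lemma mdifferentiable_divisionP_of_abs_lt_one : MDiff (divisionP x y) := by
  rw [UpperHalfPlane.mdifferentiable_iff]
  intro z (hz : 0 < z.im)
  obtain ⟨b, hb, hle⟩ := exists_summable_norm_rowTerm_le (sub_pos.2 hx)
    (sub_le_self 1 (abs_nonneg x)) (half_pos hz)
  have hU : IsOpen {w : ℂ | z.im / 2 < w.im} := isOpen_lt continuous_const Complex.continuous_im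
  have hpos {w : ℂ} (hw : z.im / 2 < w.im) : 0 < w.im := (half_pos hz).trans hw
  have hrows : DifferentiableOn ℂ (fun w => ∑' m, rowTerm m w (x * w + y))
      {w : ℂ | z.im / 2 < w.im} :=
    Complex.differentiableOn_tsum_of_summable_norm hb (fun m w hw =>
      (differentiableAt_rowTerm hx hxy m (hpos hw)).differentiableWithinAt) hU
      fun m w hw => hle m w _ (le_of_lt hw) <| by
        rw [abs_im_ofReal_mul_add (hpos hw), sub_sub_cancel]
  have hleading : DifferentiableAt ℂ (fun w : ℂ => 1 / 12 + qFrac (x * w + y)) z :=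
    .const_add _ ((differentiableAt_qFrac
      (ofReal_mul_add_mem_integerComplement hx hxy hz)).fun_comp' z (by fun_prop))
  have hsum := hleading.add (hrows.differentiableAt (hU.mem_nhds (half_lt_self hz)))
  refine (hsum.congr_of_eventuallyEq ?_).differentiableWithinAt
  filter_upwards [isOpen_upperHalfPlaneSet.mem_nhds hz] with w hw
  rw [Function.comp, divisionP_eq hx hxy, ofComplex_apply_of_im_pos hw]
  rfl

lemma tendsto_divisionP_of_abs_lt_one :
    Tendsto (divisionP x y) atImInfty (𝓝 (1 / 12 + if x = 0 then qFrac y else 0)) := by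
  have hleading : Tendsto (fun τ : ℍ => qFrac (x * τ + y)) atImInfty
      (𝓝 (if x = 0 then qFrac y else 0)) := by
    split_ifs with hx0
    · simp [hx0]
    · exact tendsto_qFrac <| (tendsto_im_atImInfty.const_mul_atTop (abs_pos.2 hx0)).congr fun τ =>
        (abs_im_ofReal_mul_add τ.im_pos).symm
  have hsum := (hleading.const_add (1 / 12)).add (tendsto_tsum_rowTerm hx y)
  rw [add_zero] at hsum
  exact hsum.congr fun τ => (divisionP_eq hx hxy τ).symm

end Coordinates

lemma abs_fract_lt_one (x : ℝ) : |Int.fract x| < 1 := by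
  rw [Int.abs_fract]
  exact Int.fract_lt_one x

lemma mdifferentiable_divisionP {x y : ℝ} (hxy : ¬(Int.fract x = 0 ∧ Int.fract y = 0)) :
    MDiff (divisionP x y) := by
  rw [← divisionP_fract_left]
  exact mdifferentiable_divisionP_of_abs_lt_one (abs_fract_lt_one x) (by rwa [Int.fract_fract])

lemma tendsto_divisionP {x y : ℝ} (hxy : ¬(Int.fract x = 0 ∧ Int.fract y = 0)) :
    Tendsto (divisionP x y) atImInfty (𝓝 (1 / 12 + if Int.fract x = 0 then qFrac y else 0)) := by
  rw [← divisionP_fract_left]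
  exact tendsto_divisionP_of_abs_lt_one (abs_fract_lt_one x) (by rwa [Int.fract_fract])

/-! ### Fricke functions -/

/-- The Fricke function, the weight zero normalization of the division value of `℘` with real
coordinates `(x, y)`. The function `f_k` is the one with coordinates `(0, k / N)`. -/
def fricke (x y : ℝ) (τ : ℍ) : ℂ := g2 τ * g3 τ * divisionP x y τ / Delta τ

lemma fFun_eq_fricke (N : ℕ) (k : ℤ) : fFun N k = fricke 0 (k / N) := by
  funext τ
  rw [fFun, fricke, pFun, divisionP, Complex.ofReal_zero, zero_mul, zero_add, Complex.ofReal_div,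
    Complex.ofReal_intCast, Complex.ofReal_natCast, ← mul_div_assoc]

lemma fricke_add_intCast (x y : ℝ) (m n : ℤ) : fricke (x + m) (y + n) = fricke x y := by
  funext τ
  rw [fricke, fricke, divisionP_add_intCast]

lemma fricke_smul (x y : ℝ) (γ : SL(2, ℤ)) (τ : ℍ) :
    fricke x y (γ • τ) = fricke (x * γ 0 0 + y * γ 1 0) (x * γ 0 1 + y * γ 1 1) τ := by
  rw [fricke, fricke, g2_smul, g3_smul, divisionP_smul, Delta_smul,
    ← mul_div_mul_left _ (Delta τ) (pow_ne_zero 12 (denom_ne_zero γ τ))]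
  ring

lemma fract_eq_zero_of_fract_vecMul_eq_zero {x y : ℝ} (γ : SL(2, ℤ))
    (h : Int.fract (x * γ 0 0 + y * γ 1 0) = 0 ∧ Int.fract (x * γ 0 1 + y * γ 1 1) = 0) :
    Int.fract x = 0 ∧ Int.fract y = 0 := by
  simp only [Int.fract_eq_zero_iff, Set.mem_range] at h ⊢
  obtain ⟨⟨m, hm⟩, n, hn⟩ := h
  have hdet : (γ 0 0 * γ 1 1 - γ 0 1 * γ 1 0 : ℝ) = 1 := by
    exact_mod_cast (Matrix.det_fin_two γ.1).symm.trans γ.2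
  refine ⟨⟨m * γ 1 1 - n * γ 1 0, ?_⟩, ⟨n * γ 0 0 - m * γ 0 1, ?_⟩⟩
  · push_cast
    linear_combination γ 1 1 * hm - γ 1 0 * hn + x * hdet
  · push_cast
    linear_combination γ 0 0 * hn - γ 0 1 * hm + y * hdet

lemma divisionP_natCast_vadd {N : ℕ} {x : ℝ} {a : ℤ} (hx : N * x = a) (y : ℝ) (τ : ℍ) :
    divisionP x y ((N : ℝ) +ᵥ τ) = divisionP x y τ := by
  have hT : ((N : ℝ) +ᵥ τ) = ModularGroup.T ^ (N : ℤ) • τ := by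
    rw [modular_T_zpow_smul, Int.cast_natCast]
  rw [hT, divisionP_smul, ← divisionP_add_intCast x y 0 a, ← hx, ModularGroup.denom_apply]
  simp only [ModularGroup.coe_T_zpow, Matrix.of_apply, Matrix.cons_val', Matrix.cons_val_zero,
    Matrix.cons_val_one, Matrix.cons_val_fin_one]
  simp [mul_comm, add_comm y]

section NonIntegral

variable {x y : ℝ} (hxy : ¬(Int.fract x = 0 ∧ Int.fract y = 0))
include hxy

lemma mdifferentiable_fricke : MDiff (fricke x y) := by
  rw [UpperHalfPlane.mdifferentiable_iff]
  exact (((UpperHalfPlane.mdifferentiable_iff.1 mdifferentiable_g2).mul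
    (UpperHalfPlane.mdifferentiable_iff.1 mdifferentiable_g3)).mul
    (UpperHalfPlane.mdifferentiable_iff.1 (mdifferentiable_divisionP hxy))).div
    (UpperHalfPlane.mdifferentiable_iff.1 mdifferentiable_Delta) fun z _ => Delta_ne_zero _

lemma isMeromorphicAtInfty_fricke {N : ℕ} (hN : 0 < N) {a : ℤ} (hx : N * x = a) :
    IsMeromorphicAtInfty N (fricke x y) := by
  have hdivision : IsMeromorphicAtInfty N (divisionP x y) :=
    isMeromorphicAtInfty_of_isBoundedAtImInfty hN (mdifferentiable_divisionP hxy)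
      (divisionP_natCast_vadd hx y) ((tendsto_divisionP hxy).isBigO_one (F := ℝ))
  exact (((isMeromorphicAtInfty_g2 hN).mul (isMeromorphicAtInfty_g3 hN)).mul hdivision).div
    (isMeromorphicAtInfty_Delta hN)

lemma isMeromorphicAtCusps_fricke {N : ℕ} (hN : 0 < N) {a b : ℤ} (hx : N * x = a)
    (hy : N * y = b) : IsMeromorphicAtCusps N (fricke x y) := by
  refine isMeromorphicAtCusps_iff.2 fun γ => ?_
  simp only [fricke_smul]
  refine isMeromorphicAtInfty_fricke (fun h => hxy (fract_eq_zero_of_fract_vecMul_eq_zero γ h)) hN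
    (a := a * γ 0 0 + b * γ 1 0) ?_
  push_cast
  rw [← hx, ← hy]
  ring

end NonIntegral

lemma eventually_ne_zero_of_qExpansion_coeff_zero {F : Type*} [FunLike F ℍ ℂ] {k : ℤ}
    [ModularFormClass F 𝒮ℒ k] (f : F) (hf : (qExpansion 1 f).coeff 0 ≠ 0) :
    ∀ᶠ τ in atImInfty, f τ ≠ 0 := by
  have hlim := (ModularFormClass.analyticAt_cuspFunction_zero f one_pos
    one_mem_strictPeriods_SL).continuousAt.tendsto.comp (qParam_tendsto_atImInfty one_pos)
  have hcoeff : cuspFunction 1 f 0 ≠ 0 := by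
    simpa [UpperHalfPlane.qExpansion_coeff, iteratedDeriv_zero] using hf
  filter_upwards [hlim.eventually_ne hcoeff] with τ hτ
  rwa [Function.comp, SlashInvariantFormClass.eq_cuspFunction f τ one_mem_strictPeriods_SL
    one_ne_zero] at hτ

lemma eventually_g2_mul_g3_ne_zero : ∀ᶠ τ in atImInfty, g2 τ * g3 τ ≠ 0 := by
  have hE₄ : (qExpansion 1 E₄).coeff 0 = 1 := E_qExpansion_coeff_zero _ ⟨2, rfl⟩
  have hE₆ : (qExpansion 1 E₆).coeff 0 = 1 := E_qExpansion_coeff_zero _ ⟨3, rfl⟩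
  filter_upwards [eventually_ne_zero_of_qExpansion_coeff_zero E₄ (hE₄ ▸ one_ne_zero),
    eventually_ne_zero_of_qExpansion_coeff_zero E₆ (hE₆ ▸ one_ne_zero)] with τ h4 h6
  simp [g2_eq_smul_E₄, g3_eq_smul_E₆, h4, h6, Real.pi_ne_zero]

/-- The coordinates are read off the limit at `i∞` after cancelling `g2 * g3 / Delta`. -/
lemma coordinates_of_fricke_eq {x y y₀ : ℝ} (hxy : ¬(Int.fract x = 0 ∧ Int.fract y = 0))
    (hy₀ : Int.fract y₀ ≠ 0) (h : fricke x y = fricke 0 y₀) :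
    Int.fract x = 0 ∧ (Int.fract (y - y₀) = 0 ∨ Int.fract (y + y₀) = 0) := by
  have hy₀' : ¬(Int.fract (0 : ℝ) = 0 ∧ Int.fract y₀ = 0) := fun h => hy₀ h.2
  have hdivision : divisionP x y =ᶠ[atImInfty] divisionP 0 y₀ := by
    filter_upwards [eventually_g2_mul_g3_ne_zero] with τ hτ
    have hτ' := congrFun h τ
    rw [fricke, fricke, div_left_inj' (Delta_ne_zero τ)] at hτ'
    exact mul_left_cancel₀ hτ hτ'
  have hlim := tendsto_nhds_unique ((tendsto_divisionP hxy).congr' hdivision)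
    (tendsto_divisionP hy₀')
  rw [if_pos Int.fract_zero, add_right_inj] at hlim
  have hmem {t : ℝ} : (t : ℂ) ∈ integerComplement ↔ Int.fract t ≠ 0 := by
    rw [ne_eq, Int.fract_eq_zero_iff]
    exact not_congr (exists_congr fun n => by norm_cast)
  by_cases hx : Int.fract x = 0
  · rw [if_pos hx] at hlim
    refine ⟨hx, ?_⟩
    simpa only [← Complex.ofReal_sub, ← Complex.ofReal_add, hmem, not_not] using
      sub_or_add_notMem_of_qFrac_eq (hmem.2 fun hy => hxy ⟨hx, hy⟩) (hmem.2 hy₀) hlim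
  · rw [if_neg hx] at hlim
    exact absurd hlim.symm (qFrac_ne_zero (hmem.2 hy₀))

/-! ### The field of modular functions for `Γ₁(N)` -/

section GammaOne

variable {N : ℕ} {k : ℤ}

lemma mem_Gamma1_of_dvd {γ : SL(2, ℤ)} (hc : (N : ℤ) ∣ γ 1 0) (hd : (N : ℤ) ∣ γ 1 1 - 1) :
    γ ∈ CongruenceSubgroup.Gamma1 N := by
  rw [← ZMod.intCast_zmod_eq_zero_iff_dvd] at hc hd
  rw [Int.cast_sub, Int.cast_one, sub_eq_zero] at hd
  refine (CongruenceSubgroup.Gamma1_mem N γ).2 ⟨?_, hd, hc⟩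
  have hdet : γ 0 0 * γ 1 1 - γ 0 1 * γ 1 0 = 1 := (Matrix.det_fin_two γ.1).symm.trans γ.2
  simpa [hc, hd] using congrArg (Int.cast : ℤ → ZMod N) hdet

lemma fract_div_mul_eq_zero_iff (hN : 0 < N) (hk : IsCoprime k (N : ℤ)) {a : ℤ} :
    Int.fract (k / N * a : ℝ) = 0 ↔ (N : ℤ) ∣ a := by
  have hN' : (N : ℝ) ≠ 0 := by positivity
  have hcancel : (N : ℤ) ∣ a ↔ (N : ℤ) ∣ k * a :=
    ⟨fun h => h.mul_left k, hk.symm.dvd_of_dvd_mul_left⟩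
  rw [hcancel, Int.fract_eq_zero_iff]
  refine exists_congr fun n => ?_
  rw [eq_comm, div_mul_eq_mul_div, div_eq_iff hN', mul_comm (n : ℝ)]
  norm_cast

lemma fract_div_ne_zero (hN : 1 < N) (hk : IsCoprime k (N : ℤ)) : Int.fract (k / N : ℝ) ≠ 0 := by
  have hdvd := fract_div_mul_eq_zero_iff (by omega) hk (a := 1)
  rw [Int.cast_one, mul_one] at hdvd
  rw [ne_eq, hdvd, ← isUnit_iff_dvd_one, Int.isUnit_iff]
  omega

lemma fricke_smul_of_mem_Gamma1 (hN : 0 < N) (k : ℤ) {γ : SL(2, ℤ)}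
    (hγ : γ ∈ CongruenceSubgroup.Gamma1 N) (τ : ℍ) :
    fricke 0 (k / N) (γ • τ) = fricke 0 (k / N) τ := by
  obtain ⟨-, hd, hc⟩ := (CongruenceSubgroup.Gamma1_mem N γ).1 hγ
  obtain ⟨c, hc⟩ := (ZMod.intCast_zmod_eq_zero_iff_dvd _ _).1 hc
  obtain ⟨d, hd⟩ := (ZMod.intCast_eq_intCast_iff_dvd_sub 1 _ N).1 (by rw [hd, Int.cast_one])
  rw [fricke_smul, ← fricke_add_intCast 0 _ (k * c) (k * d), hc, eq_add_of_sub_eq hd]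
  congr 1
  all_goals
    push_cast
    field_simp
    ring

lemma mem_Gamma1_or_neg_mem (hN : 1 < N) (hk : IsCoprime k (N : ℤ)) {γ : SL(2, ℤ)}
    (h : ∀ τ, fricke 0 (k / N) (γ • τ) = fricke 0 (k / N) τ) :
    γ ∈ CongruenceSubgroup.Gamma1 N ∨ -γ ∈ CongruenceSubgroup.Gamma1 N := by
  have hN0 : 0 < N := by omega
  have hk0 := fract_div_ne_zero hN hk
  obtain ⟨hc, hd⟩ := coordinates_of_fricke_eq
    (fun hγ => hk0 (fract_eq_zero_of_fract_vecMul_eq_zero γ hγ).2) hk0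
    (funext fun τ => (fricke_smul 0 (k / N) γ τ).symm.trans (h τ))
  have hsub : (k / N * γ 1 1 - k / N : ℝ) = k / N * (γ 1 1 - 1 : ℤ) := by push_cast; ring
  have hadd : (k / N * γ 1 1 + k / N : ℝ) = k / N * (γ 1 1 + 1 : ℤ) := by push_cast; ring
  rw [zero_mul, zero_add, fract_div_mul_eq_zero_iff hN0 hk] at hc
  rw [zero_mul, zero_add, hsub, hadd, fract_div_mul_eq_zero_iff hN0 hk,
    fract_div_mul_eq_zero_iff hN0 hk] at hd
  refine hd.imp (mem_Gamma1_of_dvd hc) fun hd => mem_Gamma1_of_dvd ?_ ?_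
  · simpa using hc
  · rwa [Matrix.SpecialLinearGroup.coe_neg, Matrix.neg_apply, ← neg_add', dvd_neg]

lemma toField_fricke_mem (hN : 1 < N) (hk : IsCoprime k (N : ℤ))
    (hf : IsMeromorphic (fricke 0 (k / N))) :
    toField (fricke 0 (k / N)) hf ∈
      modularFunctionField (CongruenceSubgroup.Gamma1 N) N := by
  have hN0 : 0 < N := by omega
  refine toField_mem_modularFunctionField_iff.2 ⟨fun γ hγ => smul_toField_eq_self_iff.2 <|
    Eventually.of_forall (fricke_smul_of_mem_Gamma1 hN0 k (inv_mem hγ)), ?_⟩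
  exact isMeromorphicAtCusps_fricke (fun h => fract_div_ne_zero hN hk h.2) hN0
    (a := 0) (b := k) (by simp) (by field_simp)

lemma mem_Gamma1_or_neg_mem_of_smul_toField_fricke (hN : 1 < N) (hk : IsCoprime k (N : ℤ))
    {hf : IsMeromorphic (fricke 0 (k / N))} {γ : SL(2, ℤ)}
    (h : γ • toField (fricke 0 (k / N)) hf = toField (fricke 0 (k / N)) hf) :
    γ ∈ CongruenceSubgroup.Gamma1 N ∨ -γ ∈ CongruenceSubgroup.Gamma1 N := by
  have hcont : Continuous (fricke 0 (k / N)) :=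
    (mdifferentiable_fricke fun h => fract_div_ne_zero hN hk h.2).continuous
  have hinv := congrFun (eq_of_eventually_codiscrete
    (hcont.comp (continuous_const_smul ((γ⁻¹ : SL(2, ℤ)) : GL (Fin 2) ℝ))) hcont
    (smul_toField_eq_self_iff.1 h))
  refine (mem_Gamma1_or_neg_mem hN hk hinv).imp (inv_mem_iff.1 ·) fun hγ => ?_
  rwa [← inv_neg, inv_mem_iff] at hγ

end GammaOne

end ModularFunctions

end

theorem proposition6p1 (N : ℕ) (hN : 1 < N) (k : ℤ) (hk : IsCoprime k (N : ℤ)) :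
    ∃ (hj : ModularFunctions.IsMeromorphic ModularFunctions.jInv)
      (hf : ModularFunctions.IsMeromorphic (ModularFunctions.fFun N k)),
      IntermediateField.adjoin ℂ
        {ModularFunctions.toField ModularFunctions.jInv hj,
          ModularFunctions.toField (ModularFunctions.fFun N k) hf} =
      ModularFunctions.modularFunctionField (CongruenceSubgroup.Gamma1 N) N := by
  open ModularFunctions in
  have hN0 : 0 < N := by omega
  have : NeZero N := ⟨hN0.ne'⟩
  rw [fFun_eq_fricke]
  have hf : IsMeromorphic (fricke 0 (k / N)) := isMeromorphic_of_mdifferentiable <|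
    mdifferentiable_fricke fun h => fract_div_ne_zero hN hk h.2
  exact ⟨isMeromorphic_jInv, hf, adjoin_jInv_eq_modularFunctionField hN0
    (toField_fricke_mem hN hk hf) fun _ => mem_Gamma1_or_neg_mem_of_smul_toField_fricke hN hk⟩
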